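/- All vector spaces are over $\mathbb{Q}$. A DGL is a differential graded Lie algebra $L=(L_*,\partial)$, graded by the non-negative integers (not necessarily connected), with $\partial$ of degree $-1$; $H_*(L)$ denotes the graded Lie algebra given by the homology of its underlying chain complex, and $(H_*(L),0)$ is this Lie algebra regarded as a DGL with zero differential. Two DGLs are weakly equivalent ($\simeq$) if they are joined by a finite zigzag of quasi-isomorphisms of DGLs. $\mathrm{Ab}(L)=L/[L,L]$ is the abelianization, a chain complex. A DGL is free if it is the free DGL $\mathbb{L}(V)$ on a chain complex $V$ (equivalently, a coproduct of DGL spheres and DGL disks). A free simplicial resolution of $L$ is an augmented simplicial DGL $A_\bullet\to L$ such that each $A_n$ is free, on generating complexes that can be chosen so that the degeneracies carry generators to generators, and such that $\pi_sH_t(A_\bullet)\to\pi_sH_t(L)$ is an isomorphism for all $s,t\ge 0$, where $L$ is regarded as a constant simplicial object. The bigraded Quillen homology of $L$ is $$H_{s,t}(L):=\pi_sH_t(\mathrm{Ab}(A_\bullet)),$$ and its bigraded cohomology with coefficients in a chain complex $M$ (an abelian DGL) is $$H^s_t(L;M):=\pi^s\,[\Sigma^t\mathrm{Ab}(A_\bullet),M],$$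 where $[\Sigma^tX,M]$ denotes the vector space of chain homotopy classes of chain maps $X\to M$ of degree $t\in\mathbb{Z}$. **Proposition.** Let $L$ be any DGL, and let $L'\simeq(H_*(L),0)$ be a coformal model for $L$. Then, whichever free simplicial resolutions of $L$ and $L'$ are used to compute homology and cohomology, there is a monomorphism of bigraded vector spaces $$H_{n,t}(L)\hookrightarrow H_{n,t}(L')\qquad(n,t\ge 0),$$ and, for every chain complex $M$ of vector spaces (in particular for every graded vector space $M$ with zero differential, the case of trivial coefficients), there is a monomorphism of bigraded vector spaces $$H^n_t(L;M)\hookrightarrow H^n_t(L';M)\qquad(n\ge 0,\ t\in\mathbb{Z}).$$ -/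

import Mathlib

open CategoryTheory Opposite AlgebraicTopology
open scoped Simplicial

universe u

noncomputable section

/-- Non-negatively graded chain complexes of rational vector spaces. -/
abbrev RatComplex : Type (u + 1) := ChainComplex (ModuleCat.{u} ℚ) ℕ

/-- A differential graded Lie algebra over `ℚ`, graded by the natural numbers (not necessarily
connected).  The bracket of degrees `p`, `q` is recorded with an arbitrary target degree `r` and
is zero unless `p + q = r`, just as the differential `X.d i j` is zero unless `j + 1 = i`.
In particular `X.d p (p - 1)` is the differential out of degree `p`; it is zero for `p = 0`. -/
structure DGL : Type (u + 1) where
  X : RatComplex.{u}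
  bracket : ∀ p q r : ℕ, X.X p →ₗ[ℚ] X.X q →ₗ[ℚ] X.X r
  bracket_shape : ∀ p q r : ℕ, p + q ≠ r → bracket p q r = 0
  bracket_symm : ∀ (p q r : ℕ) (x : X.X p) (y : X.X q),
    bracket p q r x y = (-1 : ℚ) ^ (p * q + 1) • bracket q p r y x
  jacobi : ∀ (p q r : ℕ) (x : X.X p) (y : X.X q) (z : X.X r),
    (-1 : ℚ) ^ (p * r) • bracket (p + q) r (p + q + r) (bracket p q (p + q) x y) z
      + (-1 : ℚ) ^ (q * p) • bracket (q + r) p (p + q + r) (bracket q r (q + r) y z) x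
      + (-1 : ℚ) ^ (r * q) • bracket (r + p) q (p + q + r) (bracket r p (r + p) z x) y = 0
  d_bracket : ∀ (p q r : ℕ), p + q = r → ∀ (x : X.X p) (y : X.X q),
    (X.d r (r - 1)).hom (bracket p q r x y)
      = bracket (p - 1) q (r - 1) ((X.d p (p - 1)).hom x) y
        + (-1 : ℚ) ^ p • bracket p (q - 1) (r - 1) x ((X.d q (q - 1)).hom y)

namespace DGL

/-- Morphisms of DGLs: chain maps that preserve the bracket. -/
@[ext]
structure Hom (K L : DGL.{u}) : Type u where
  f : K.X ⟶ L.X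
  map_bracket : ∀ (p q r : ℕ) (x : K.X.X p) (y : K.X.X q),
    (f.f r).hom (K.bracket p q r x y) = L.bracket p q r ((f.f p).hom x) ((f.f q).hom y)

instance : Category DGL.{u} where
  Hom := Hom
  id K := ⟨𝟙 K.X, fun _ _ _ _ _ => rfl⟩
  comp F G := ⟨F.f ≫ G.f, fun p q r x y => by
    simp [F.map_bracket, G.map_bracket]⟩

/-- The underlying chain complex of a DGL. -/
def toComplex : DGL.{u} ⥤ RatComplex.{u} where
  obj K := K.X
  map F := Hom.f F

/-! ### Homology of the underlying complex, and the coformal model -/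

/-- Cycles of degree `n`. -/
def cyc (L : DGL.{u}) (n : ℕ) : Submodule ℚ (L.X.X n) :=
  LinearMap.ker (L.X.d n (n - 1)).hom

/-- Boundaries of degree `n`. -/
def bdry (L : DGL.{u}) (n : ℕ) : Submodule ℚ (L.X.X n) :=
  LinearMap.range (L.X.d (n + 1) n).hom

/-- The homology `H_n(L)` of the underlying chain complex of `L`. -/
abbrev Hmod (L : DGL.{u}) (n : ℕ) : Type u := L.cyc n ⧸ (L.bdry n).submoduleOf (L.cyc n)

lemma bracket_cyc (L : DGL.{u}) (p q r : ℕ) (x : L.cyc p) (y : L.cyc q) :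
    L.bracket p q r x y ∈ L.cyc r := by
  by_cases h : p + q = r
  · have hx : (L.X.d p (p - 1)).hom (x : L.X.X p) = 0 := x.2
    have hy : (L.X.d q (q - 1)).hom (y : L.X.X q) = 0 := y.2
    rw [cyc, LinearMap.mem_ker, L.d_bracket p q r h, hx, hy]
    simp
  · rw [L.bracket_shape p q r h]
    simp

lemma bracket_bdry_left (L : DGL.{u}) (p q r : ℕ) (x : L.X.X p) (hx : x ∈ L.bdry p)
    (y : L.cyc q) : L.bracket p q r x y ∈ L.bdry r := by
  by_cases h : p + q = r
  · obtain ⟨a, rfl⟩ := hx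
    have hy : (L.X.d q (q - 1)).hom (y : L.X.X q) = 0 := y.2
    refine ⟨L.bracket (p + 1) q (r + 1) a y, ?_⟩
    have := L.d_bracket (p + 1) q (r + 1) (by omega) a y
    rw [hy] at this
    simpa using this
  · rw [L.bracket_shape p q r h]
    simp

lemma bracket_bdry_right (L : DGL.{u}) (p q r : ℕ) (x : L.cyc p) (y : L.X.X q)
    (hy : y ∈ L.bdry q) : L.bracket p q r x y ∈ L.bdry r := by
  rw [L.bracket_symm]
  exact Submodule.smul_mem _ _ (L.bracket_bdry_left q p r y hy x)

/-- The bracket of cycles. -/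
def cycBracket (L : DGL.{u}) (p q r : ℕ) : L.cyc p →ₗ[ℚ] L.cyc q →ₗ[ℚ] L.cyc r :=
  LinearMap.mk₂ ℚ (fun x y => ⟨L.bracket p q r x y, L.bracket_cyc p q r x y⟩)
    (fun _ _ _ => by ext; simp) (fun _ _ _ => by ext; simp)
    (fun _ _ _ => by ext; simp) (fun _ _ _ => by ext; simp)

/-- The bracket of a cycle with a homology class. -/
def cycHomBracket (L : DGL.{u}) (p q r : ℕ) : L.cyc p →ₗ[ℚ] L.Hmod q →ₗ[ℚ] L.Hmod r where
  toFun x := Submodule.mapQ _ _ (L.cycBracket p q r x) (fun y hy =>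
    L.bracket_bdry_right p q r x y hy)
  map_add' x x' := by
    apply Submodule.linearMap_qext
    ext y : 1
    exact congrArg Submodule.Quotient.mk (by simp)
  map_smul' c x := by
    apply Submodule.linearMap_qext
    ext y : 1
    exact congrArg Submodule.Quotient.mk (by simp)

/-- The bracket induced on homology: `[[x], [y]] = [[x, y]]`. -/
def homBracket (L : DGL.{u}) (p q r : ℕ) : L.Hmod p →ₗ[ℚ] L.Hmod q →ₗ[ℚ] L.Hmod r :=
  Submodule.liftQ _ (L.cycHomBracket p q r) (fun x hx => by
    rw [LinearMap.mem_ker]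
    apply Submodule.linearMap_qext
    ext y
    exact (Submodule.Quotient.mk_eq_zero _).2 (L.bracket_bdry_left p q r x hx y))

lemma homBracket_mk (L : DGL.{u}) (p q r : ℕ) (x : L.cyc p) (y : L.cyc q) :
    L.homBracket p q r (Submodule.Quotient.mk x) (Submodule.Quotient.mk y)
      = Submodule.Quotient.mk (L.cycBracket p q r x y) := rfl

lemma homBracket_shape (L : DGL.{u}) (p q r : ℕ) (h : p + q ≠ r) : L.homBracket p q r = 0 := by
  apply Submodule.linearMap_qext
  ext x : 1
  apply Submodule.linearMap_qext
  ext y : 1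
  have h0 : L.cycBracket p q r x y = 0 := by
    ext
    simp [cycBracket, L.bracket_shape p q r h]
  exact (L.homBracket_mk p q r x y).trans (congrArg Submodule.Quotient.mk h0)

lemma homBracket_symm (L : DGL.{u}) (p q r : ℕ) (x : L.Hmod p) (y : L.Hmod q) :
    L.homBracket p q r x y = (-1 : ℚ) ^ (p * q + 1) • L.homBracket q p r y x := by
  obtain ⟨x, rfl⟩ := Submodule.Quotient.mk_surjective _ x
  obtain ⟨y, rfl⟩ := Submodule.Quotient.mk_surjective _ y
  rw [homBracket_mk, homBracket_mk, ← Submodule.Quotient.mk_smul]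
  congr 1
  ext
  exact L.bracket_symm p q r x y

lemma homBracket_jacobi (L : DGL.{u}) (p q r : ℕ) (x : L.Hmod p) (y : L.Hmod q) (z : L.Hmod r) :
    (-1 : ℚ) ^ (p * r) • L.homBracket (p + q) r (p + q + r) (L.homBracket p q (p + q) x y) z
      + (-1 : ℚ) ^ (q * p) • L.homBracket (q + r) p (p + q + r) (L.homBracket q r (q + r) y z) x
      + (-1 : ℚ) ^ (r * q) • L.homBracket (r + p) q (p + q + r) (L.homBracket r p (r + p) z x) y
      = 0 := by
  obtain ⟨x, rfl⟩ := Submodule.Quotient.mk_surjective _ x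
  obtain ⟨y, rfl⟩ := Submodule.Quotient.mk_surjective _ y
  obtain ⟨z, rfl⟩ := Submodule.Quotient.mk_surjective _ z
  simp only [homBracket_mk]
  rw [← Submodule.Quotient.mk_smul, ← Submodule.Quotient.mk_smul, ← Submodule.Quotient.mk_smul,
    ← Submodule.Quotient.mk_add, ← Submodule.Quotient.mk_add, Submodule.Quotient.mk_eq_zero]
  convert Submodule.zero_mem _
  ext
  exact L.jacobi p q r x y z

lemma homBracket_zero (L : DGL.{u}) (p q r : ℕ) (x : L.Hmod p) (y : L.Hmod q) :
    (0 : L.Hmod (r - 1)) = L.homBracket (p - 1) q (r - 1) 0 y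
      + (-1 : ℚ) ^ p • L.homBracket p (q - 1) (r - 1) x 0 := by
  rw [map_zero, map_zero, LinearMap.zero_apply, smul_zero, add_zero]

/-- The homology of `L` with zero differential, as a chain complex. -/
def homologyComplex (L : DGL.{u}) : RatComplex.{u} where
  X n := ModuleCat.of ℚ (L.Hmod n)
  d _ _ := 0

/-- The DGL `(H_*(L), 0)`: the homology of `L` with the induced bracket and zero differential. -/
def homologyDGL (L : DGL.{u}) : DGL.{u} where
  X := L.homologyComplex
  bracket p q r := L.homBracket p q r
  bracket_shape p q r h := L.homBracket_shape p q r h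
  bracket_symm p q r x y := L.homBracket_symm p q r x y
  jacobi p q r x y z := L.homBracket_jacobi p q r x y z
  d_bracket p q r _ x y := L.homBracket_zero p q r x y

/-- `K ≃ L`: the equivalence relation generated by quasi-isomorphisms of DGLs. -/
def WeaklyEquivalent (K L : DGL.{u}) : Prop :=
  Relation.EqvGen (fun K L : DGL.{u} => ∃ F : K ⟶ L, QuasiIso (toComplex.map F)) K L

/-! ### Abelianization -/

/-- The span of all brackets, in degree `n`; these form the ideal `[L, L]`. -/
def decomposables (L : DGL.{u}) (n : ℕ) : Submodule ℚ (L.X.X n) :=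
  Submodule.span ℚ {z | ∃ (p q : ℕ) (x : L.X.X p) (y : L.X.X q), z = L.bracket p q n x y}

lemma d_decomposables (L : DGL.{u}) (i j : ℕ) :
    L.decomposables i ≤ (L.decomposables j).comap (L.X.d i j).hom := by
  by_cases h : j + 1 = i
  · obtain rfl : j = i - 1 := by omega
    refine Submodule.span_le.2 ?_
    rintro z ⟨p, q, x, y, rfl⟩
    by_cases hpq : p + q = i
    · simp only [SetLike.mem_coe, Submodule.mem_comap]
      rw [L.d_bracket p q i hpq]
      exact add_mem (Submodule.subset_span ⟨_, _, _, _, rfl⟩)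
        (Submodule.smul_mem _ _ (Submodule.subset_span ⟨_, _, _, _, rfl⟩))
    · rw [L.bracket_shape p q i hpq]
      simp
  · rw [L.X.shape i j (by simpa using h)]
    intro z _
    simp

lemma map_decomposables {K L : DGL.{u}} (F : K ⟶ L) (n : ℕ) :
    K.decomposables n ≤ (L.decomposables n).comap ((Hom.f F).f n).hom := by
  refine Submodule.span_le.2 ?_
  rintro z ⟨p, q, x, y, rfl⟩
  simp only [SetLike.mem_coe, Submodule.mem_comap]
  rw [Hom.map_bracket F]
  exact Submodule.subset_span ⟨_, _, _, _, rfl⟩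

/-- The chain complex `L / [L, L]`. -/
def abObj (L : DGL.{u}) : RatComplex.{u} where
  X n := ModuleCat.of ℚ (L.X.X n ⧸ L.decomposables n)
  d i j := ModuleCat.ofHom (Submodule.mapQ _ _ (L.X.d i j).hom (L.d_decomposables i j))
  shape i j h := by
    ext : 1
    apply Submodule.linearMap_qext
    ext x
    simp [L.X.shape i j h]
  d_comp_d' i j k _ _ := by
    ext : 1
    apply Submodule.linearMap_qext
    ext x
    have h : (L.X.d j k).hom ((L.X.d i j).hom x) = 0 := by
      rw [← LinearMap.comp_apply, ← ModuleCat.hom_comp, L.X.d_comp_d]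
      rfl
    simp [h]

/-- The abelianization functor `Ab`, `L ↦ L / [L, L]`, from DGLs to chain complexes
(abelian DGLs, those with zero bracket, being the same as chain complexes). -/
def ab : DGL.{u} ⥤ RatComplex.{u} where
  obj L := L.abObj
  map F :=
    { f := fun n => ModuleCat.ofHom (Submodule.mapQ _ _ ((Hom.f F).f n).hom (map_decomposables F n))
      comm' := fun i j _ => by
        ext : 1
        apply Submodule.linearMap_qext
        ext x
        have h := congrArg (fun g => g.hom x) ((Hom.f F).comm i j)
        simp only [ModuleCat.hom_comp, LinearMap.comp_apply] at h
        exact congrArg Submodule.Quotient.mk h }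
  map_id L := by
    ext n : 2
    apply Submodule.linearMap_qext
    rfl
  map_comp F G := by
    ext n : 2
    apply Submodule.linearMap_qext
    rfl

/-! ### Free DGLs and free simplicial resolutions -/

/-- `ι : V ⟶ L` exhibits `L` as the free DGL `(𝕃(V), ∂)` on the chain complex `V`.  As every
complex of rational vector spaces is a direct sum of complexes `ℚ` and `ℚ ⟶ ℚ` (identity), free
DGLs in this sense are precisely the coproducts of DGL spheres and DGL disks, including disks with
boundaries identified. -/
def IsFreeOn {V : RatComplex.{u}} {L : DGL.{u}} (ι : V ⟶ toComplex.obj L) : Prop :=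
  ∀ (K : DGL.{u}) (g : V ⟶ toComplex.obj K), ∃! F : L ⟶ K, ι ≫ toComplex.map F = g

/-- A simplicial DGL is free if each `A_n` is a free DGL, on generators that can be chosen so
that all degeneracies take generators to generators. -/
def IsFreeSimplicial (A : SimplicialObject DGL.{u}) : Prop :=
  ∃ (V : ℕ → RatComplex.{u}) (ι : ∀ n, V n ⟶ toComplex.obj (A _⦋n⦌)),
    (∀ n, IsFreeOn (ι n)) ∧
    ∀ (n : ℕ) (i : Fin (n + 1)), ∃ s : V n ⟶ V (n + 1),
      ι n ≫ toComplex.map (A.σ i) = s ≫ ι (n + 1)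

end DGL

/-- `π_s H_t` of a simplicial chain complex: apply `H_t` in every simplicial dimension, and take
the `s`-th homotopy group of the resulting simplicial vector space. -/
def piH (s t : ℕ) : SimplicialObject RatComplex.{u} ⥤ ModuleCat.{u} ℚ :=
  (SimplicialObject.whiskering _ _).obj (HomologicalComplex.homologyFunctor _ _ t) ⋙
    alternatingFaceMapComplex (ModuleCat.{u} ℚ) ⋙ HomologicalComplex.homologyFunctor _ _ s

namespace DGL

/-- `ε : A ⟶ L` is a free simplicial resolution of the DGL `L` in the sense of the `E²`-model
structure: `A` is free, and `π_s H_t(A) ⟶ π_s H_t(L)` is an isomorphism for all `s`, `t`,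
where `L` is regarded as a constant simplicial DGL. -/
structure IsFreeResolution {A : SimplicialObject DGL.{u}} {L : DGL.{u}}
    (ε : A ⟶ (SimplicialObject.const DGL.{u}).obj L) : Prop where
  free : IsFreeSimplicial A
  isIso : ∀ s t : ℕ, IsIso
    ((piH s t).map (((SimplicialObject.whiskering _ _).obj toComplex).map ε))

/-- `H_{s,t} = π_s H_t(Ab A)`, computed from a free simplicial resolution `A`. -/
def bigradedHomology (A : SimplicialObject DGL.{u}) (s t : ℕ) : ModuleCat.{u} ℚ :=
  (piH s t).obj (((SimplicialObject.whiskering _ _).obj ab).obj A)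

end DGL

/-! ### Homotopy classes of maps of chain complexes, and cohomology -/

/-- Families of linear maps `X_i ⟶ M_j`. -/
abbrev HomFamily (X M : RatComplex.{u}) : Type u := ∀ i j : ℕ, X.X i →ₗ[ℚ] M.X j

/-- The part of degree `t` of the complex `Hom(X, M)`: families of maps `X_i ⟶ M_{i+t}`. -/
def homDeg (X M : RatComplex.{u}) (t : ℤ) : Submodule ℚ (HomFamily X M) where
  carrier := {f | ∀ i j : ℕ, (j : ℤ) ≠ i + t → f i j = 0}
  add_mem' hf hg i j h := by simp [hf i j h, hg i j h]
  zero_mem' _ _ _ := rfl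
  smul_mem' c f hf i j h := by simp [hf i j h]

/-- The differential `f ↦ ∂ f - (-1)^t f ∂` on the part of degree `t` of `Hom(X, M)`. -/
def homD (X M : RatComplex.{u}) (t : ℤ) : HomFamily X M →ₗ[ℚ] HomFamily X M where
  toFun f i j := (M.d (j + 1) j).hom ∘ₗ f i (j + 1)
    - ((t.negOnePow : ℤˣ) : ℤ) • (f (i - 1) j ∘ₗ (X.d i (i - 1)).hom)
  map_add' f g := by
    funext i j
    ext x
    simp
    abel
  map_smul' c f := by
    funext i j
    ext x
    simp [smul_sub, smul_comm c]

/-- Chain maps of degree `t`. -/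
def homCyc (X M : RatComplex.{u}) (t : ℤ) : Submodule ℚ (HomFamily X M) :=
  homDeg X M t ⊓ LinearMap.ker (homD X M t)

/-- Null-homotopic chain maps of degree `t`. -/
def homBdry (X M : RatComplex.{u}) (t : ℤ) : Submodule ℚ (HomFamily X M) :=
  (homDeg X M (t + 1)).map (homD X M (t + 1))

/-- Precomposition with a chain map. -/
def homPre {X Y : RatComplex.{u}} (φ : X ⟶ Y) (M : RatComplex.{u}) :
    HomFamily Y M →ₗ[ℚ] HomFamily X M where
  toFun f i j := f i j ∘ₗ (φ.f i).hom
  map_add' _ _ := rfl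
  map_smul' _ _ := rfl

lemma homPre_mem_deg {X Y : RatComplex.{u}} (φ : X ⟶ Y) (M : RatComplex.{u}) (t : ℤ)
    (f : HomFamily Y M) (hf : f ∈ homDeg Y M t) : homPre φ M f ∈ homDeg X M t := by
  intro i j h
  simp [homPre, hf i j h]

lemma homD_homPre {X Y : RatComplex.{u}} (φ : X ⟶ Y) (M : RatComplex.{u}) (t : ℤ)
    (f : HomFamily Y M) : homD X M t (homPre φ M f) = homPre φ M (homD Y M t f) := by
  funext i j
  ext x
  have h := congrArg (fun g => g.hom x) (φ.comm i (i - 1))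
  simp only [ModuleCat.hom_comp, LinearMap.comp_apply] at h
  simp [homD, homPre, h]

lemma homPre_mem_cyc {X Y : RatComplex.{u}} (φ : X ⟶ Y) (M : RatComplex.{u}) (t : ℤ) :
    homCyc Y M t ≤ (homCyc X M t).comap (homPre φ M) := by
  intro f hf
  refine ⟨homPre_mem_deg φ M t f hf.1, ?_⟩
  have h : homD Y M t f = 0 := hf.2
  change homD X M t (homPre φ M f) = 0
  rw [homD_homPre, h, map_zero]

lemma homPre_mem_bdry {X Y : RatComplex.{u}} (φ : X ⟶ Y) (M : RatComplex.{u}) (t : ℤ) :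
    homBdry Y M t ≤ (homBdry X M t).comap (homPre φ M) := by
  rintro _ ⟨h, hh, rfl⟩
  exact ⟨homPre φ M h, homPre_mem_deg φ M _ h hh, homD_homPre φ M _ h⟩

/-- The functor `X ↦ [Σ^t X, M]`: homotopy classes of chain maps `X ⟶ M` of degree `t`, that is,
the homology in degree `t` of the complex `Hom(X, M)`. -/
def hoHom (M : RatComplex.{u}) (t : ℤ) : RatComplex.{u}ᵒᵖ ⥤ ModuleCat.{u} ℚ where
  obj X := ModuleCat.of ℚ
    (homCyc X.unop M t ⧸ (homBdry X.unop M t).submoduleOf (homCyc X.unop M t))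
  map φ := ModuleCat.ofHom (Submodule.mapQ _ _
    ((homPre φ.unop M).restrict (homPre_mem_cyc φ.unop M t))
    (fun _ hf => homPre_mem_bdry φ.unop M t hf))
  map_id X := by
    ext : 1
    apply Submodule.linearMap_qext
    rfl
  map_comp φ ψ := by
    ext : 1
    apply Submodule.linearMap_qext
    rfl

/-- `H^s_t( - ; M) = π^s [Σ^t Ab(A), M]`, computed from a free simplicial resolution `A`: the
`s`-th cohomotopy group of the cosimplicial vector space `n ↦ [Σ^t Ab(A_n), M]`. -/
def DGL.bigradedCohomology (A : SimplicialObject DGL.{u}) (M : RatComplex.{u}) (s : ℕ) (t : ℤ) :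
    ModuleCat.{u} ℚ :=
  ((alternatingCofaceMapComplex (ModuleCat.{u} ℚ)).obj
    (Functor.rightOp (((SimplicialObject.whiskering _ _).obj DGL.ab).obj A) ⋙ hoHom M t)).homology s

end

/-!
If two maps out of a free DGL induce the same map on homology, then they induce chain homotopic maps
of abelianizations, and every map of homology Lie algebras out of the homology of a free DGL is
induced by a map of DGLs. Both facts follow once the homology of `𝕃(V)` is known to be generated by
`H_*(V)`; for this, contract `V` onto its homology by a homotopy and extend the homotopy to `𝕃(V)`
with the path object `K[t, dt]`, whose integration over `t` needs characteristic zero.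

So the functors `H_t(Ab(-))` and `[Σ^t Ab(-), M]` on free DGLs factor through the category with the
maps of homology DGLs as its morphisms. Seen from an object of that category, a free resolution
`A ⟶ L` has an extra degeneracy, as maps out of the homology of `𝕃(V)` are families of linear maps
on `H_*(V)` and `H_t(A) ⟶ H_t(L)` is an acyclic augmented simplicial vector space. By acyclic
models, the alternating complex of formal sums of `A` is therefore determined up to homotopy by the
graded Lie algebra `H_*(L)`, and so are the bigraded homology and cohomology. For coformal `L'` we
have `H_*(L') ≅ H_*(L)`, and the monomorphisms in question are isomorphisms.
-/

universe v w

noncomputable section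

section Comparison

open Limits

universe v₁ v₂ u₁ u₂

variable {𝒜 : Type u₁} [Category.{v₁} 𝒜] [Preadditive 𝒜] {ℬ : Type u₂} [Category.{v₂} ℬ]
  [Preadditive ℬ]

/-- `q : J Q₀ ⟶ G` makes `Q` into a resolution of `G` from the point of view of the objects
of `𝒜`. -/
structure RelativelyExact (J : 𝒜 ⥤ ℬ) {G : ℬ} (Q : ChainComplex 𝒜 ℕ) (q : J.obj (Q.X 0) ⟶ G) :
    Prop where
  zero : J.map (Q.d 1 0) ≫ q = 0
  surj : ∀ (Y : 𝒜) (g : J.obj Y ⟶ G), ∃ f : Y ⟶ Q.X 0, J.map f ≫ q = g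
  exact_zero : ∀ (Y : 𝒜) (f : Y ⟶ Q.X 0), J.map f ≫ q = 0 → ∃ g : Y ⟶ Q.X 1, g ≫ Q.d 1 0 = f
  exact_succ : ∀ (n : ℕ) (Y : 𝒜) (f : Y ⟶ Q.X (n + 1)), f ≫ Q.d (n + 1) n = 0 →
    ∃ g : Y ⟶ Q.X (n + 2), g ≫ Q.d (n + 2) (n + 1) = f

namespace RelativelyExact

variable {J : 𝒜 ⥤ ℬ} {G : ℬ} {P Q : ChainComplex 𝒜 ℕ}
  {p : J.obj (P.X 0) ⟶ G} {q : J.obj (Q.X 0) ⟶ G}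

lemma exists_lift (hp : J.map (P.d 1 0) ≫ p = 0) (hQ : RelativelyExact J Q q) :
    ∃ f : P ⟶ Q, J.map (f.f 0) ≫ q = p := by
  obtain ⟨f₀, h₀⟩ := hQ.surj (P.X 0) p
  obtain ⟨f₁, h₁⟩ := hQ.exact_zero (P.X 1) (P.d 1 0 ≫ f₀) (by
    rw [J.map_comp, Category.assoc, h₀, hp])
  have step : ∀ (n : ℕ) (s : Σ' (f : P.X n ⟶ Q.X n) (f' : P.X (n + 1) ⟶ Q.X (n + 1)),
      f' ≫ Q.d (n + 1) n = P.d (n + 1) n ≫ f), ∃ f'' : P.X (n + 2) ⟶ Q.X (n + 2),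
      f'' ≫ Q.d (n + 2) (n + 1) = P.d (n + 2) (n + 1) ≫ s.2.1 := by
    rintro n ⟨f, f', w⟩
    exact hQ.exact_succ n _ _ (by simp [w])
  choose k hk using step
  refine ⟨ChainComplex.mkHom P Q f₀ f₁ h₁ (fun n s => ⟨k n s, hk n s⟩), ?_⟩
  rw [ChainComplex.mkHom_f_0, h₀]

lemma nonempty_homotopy_zero (hQ : RelativelyExact J Q q) (f : P ⟶ Q)
    (hf : J.map (f.f 0) ≫ q = 0) : Nonempty (Homotopy f 0) := by
  obtain ⟨k₀, h₀⟩ := hQ.exact_zero _ (f.f 0) hf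
  obtain ⟨k₁, h₁⟩ := hQ.exact_succ 0 _ (f.f 1 - P.d 1 0 ≫ k₀) (by simp [h₀])
  have step : ∀ (n : ℕ) (s : Σ' (k : P.X n ⟶ Q.X (n + 1)) (k' : P.X (n + 1) ⟶ Q.X (n + 2)),
      f.f (n + 1) = P.d (n + 1) n ≫ k + k' ≫ Q.d (n + 2) (n + 1)),
      ∃ k'' : P.X (n + 2) ⟶ Q.X (n + 3),
        f.f (n + 2) = P.d (n + 2) (n + 1) ≫ s.2.1 + k'' ≫ Q.d (n + 3) (n + 2) := by
    rintro n ⟨k, k', w⟩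
    obtain ⟨k'', h''⟩ := hQ.exact_succ (n + 1) _ (f.f (n + 2) - P.d (n + 2) (n + 1) ≫ k') (by
      have w' : k' ≫ Q.d (n + 2) (n + 1) = f.f (n + 1) - P.d (n + 1) n ≫ k := by
        rw [w]; abel
      simp [w'])
    exact ⟨k'', by rw [h'']; abel⟩
  choose k hk using step
  exact ⟨Homotopy.mkInductive f k₀ h₀.symm k₁ (by rw [h₁]; abel) (fun n s => ⟨k n s, hk n s⟩)⟩

theorem nonempty_homotopyEquiv [J.Additive] (hP : RelativelyExact J P p)
    (hQ : RelativelyExact J Q q) : Nonempty (HomotopyEquiv P Q) := by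
  obtain ⟨f, hf⟩ := exists_lift hP.zero hQ
  obtain ⟨g, hg⟩ := exists_lift hQ.zero hP
  obtain ⟨H⟩ := hP.nonempty_homotopy_zero (f ≫ g - 𝟙 P) (by simp [hf, hg, Preadditive.sub_comp])
  obtain ⟨K⟩ := hQ.nonempty_homotopy_zero (g ≫ f - 𝟙 Q) (by simp [hf, hg, Preadditive.sub_comp])
  exact ⟨⟨f, g, Homotopy.equivSubZero.symm H, Homotopy.equivSubZero.symm K⟩⟩

end RelativelyExact

end Comparison

/-! ### Simplicial contractions -/

section Free

open Limits

variable {C : Type w} [Category.{v} C] {D : Type w} [Category.{v} D]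

/-- The additive extension to formal sums of a map between hom-sets. -/
def freeHomMap {X Y : C} {Z W : D} (φ : (X ⟶ Y) → (Z ⟶ W)) :
    ((Free.embedding ℤ C).obj X ⟶ (Free.embedding ℤ C).obj Y) →+
      ((Free.embedding ℤ D).obj Z ⟶ (Free.embedding ℤ D).obj W) :=
  Finsupp.mapDomain.addMonoidHom φ

lemma freeHomMap_embedding_map {X Y : C} {Z W : D} (φ : (X ⟶ Y) → (Z ⟶ W)) (f : X ⟶ Y) :
    freeHomMap φ ((Free.embedding ℤ C).map f) = (Free.embedding ℤ D).map (φ f) :=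
  Finsupp.mapDomain_single

lemma freeHom_addHom_ext {X Y : C} {M : Type*} [AddCommGroup M]
    {F G : ((Free.embedding ℤ C).obj X ⟶ (Free.embedding ℤ C).obj Y) →+ M}
    (h : ∀ f : X ⟶ Y, F ((Free.embedding ℤ C).map f) = G ((Free.embedding ℤ C).map f)) : F = G :=
  Finsupp.addHom_ext' fun f => AddMonoidHom.ext_int (h f)

/-- The functor induced on free preadditive categories. -/
def freeFunctor (J : C ⥤ D) : Free ℤ C ⥤ Free ℤ D := Free.lift ℤ (J ⋙ Free.embedding ℤ D)

instance (J : C ⥤ D) : (freeFunctor J).Additive := Free.lift_additive ℤ _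

lemma freeFunctor_map_embedding_map (J : C ⥤ D) {X Y : C} (f : X ⟶ Y) :
    (freeFunctor J).map ((Free.embedding ℤ C).map f) = (Free.embedding ℤ D).map (J.map f) :=
  (Free.lift_map_single ℤ (J ⋙ Free.embedding ℤ D) f 1).trans (one_smul _ _)

lemma freeFunctor_map_comp_embedding_map (J : C ⥤ D) {X Y : C} {Z : D} (g : J.obj Y ⟶ Z)
    (f : (Free.embedding ℤ C).obj X ⟶ (Free.embedding ℤ C).obj Y) :
    (freeFunctor J).map f ≫ (Free.embedding ℤ D).map g =
      freeHomMap (fun f : X ⟶ Y => J.map f ≫ g) f := by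
  let E := (Free.embedding ℤ C).obj
  suffices h : (Preadditive.rightComp ((freeFunctor J).obj (E X)) ((Free.embedding ℤ D).map g)).comp
      ((freeFunctor J).mapAddHom (X := E X) (Y := E Y)) = freeHomMap (fun f : X ⟶ Y => J.map f ≫ g)
    from DFunLike.congr_fun h f
  refine freeHom_addHom_ext fun f => ?_
  refine (congrArg (· ≫ (Free.embedding ℤ D).map g) (freeFunctor_map_embedding_map J f)).trans ?_
  exact ((Free.embedding ℤ D).map_comp _ _).symm.trans
    (freeHomMap_embedding_map (fun f : X ⟶ Y => J.map f ≫ g) f).symm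

end Free

section AlternatingFaceMapComplex

variable {C : Type w} [Category.{v} C]

lemma alternatingFaceMapComplex_d_one_zero [Preadditive C] (X : SimplicialObject C) :
    ((alternatingFaceMapComplex C).obj X).d 1 0 = X.δ 0 - X.δ 1 := by
  rw [alternatingFaceMapComplex_obj_d, AlternatingFaceMapComplex.objD, Fin.sum_univ_two]
  simp [sub_eq_add_neg]

/-- The alternating face map complex of `X` in the free preadditive category. -/
abbrev freeComplex (X : SimplicialObject C) : ChainComplex (Free ℤ C) ℕ :=
  (alternatingFaceMapComplex (Free ℤ C)).obj
    (((SimplicialObject.whiskering _ _).obj (Free.embedding ℤ C)).obj X)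

/-- The differential of `freeComplex X`, between objects in the image of the embedding. -/
def freeD (X : SimplicialObject C) (n : ℕ) :
    (Free.embedding ℤ C).obj (X _⦋n + 1⦌) ⟶ (Free.embedding ℤ C).obj (X _⦋n⦌) :=
  (freeComplex X).d (n + 1) n

lemma freeD_eq_sum (X : SimplicialObject C) (n : ℕ) :
    freeD X n = ∑ i : Fin (n + 2), (-1 : ℤ) ^ (i : ℕ) • (Free.embedding ℤ C).map (X.δ i) :=
  alternatingFaceMapComplex_obj_d _ _

lemma embedding_map_comp_freeD (X : SimplicialObject C) {Y : C} (n : ℕ) (f : Y ⟶ X _⦋n + 1⦌) :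
    (Free.embedding ℤ C).map f ≫ freeD X n =
      ∑ i : Fin (n + 2), (-1 : ℤ) ^ (i : ℕ) • (Free.embedding ℤ C).map (f ≫ X.δ i) := by
  simp only [freeD_eq_sum, Preadditive.comp_sum, Preadditive.comp_zsmul, Functor.map_comp]

end AlternatingFaceMapComplex

/-- A contraction of the augmented simplicial set `C(Y, X) ⟶ D(J Y, G)`: extra degeneracies `h`,
of which only the identities with the faces are required. -/
structure SimplicialContraction {C : Type w} [Category.{v} C] {D : Type w} [Category.{v} D]
    (J : C ⥤ D) (X : SimplicialObject C) {G : D} (ε : J.obj (X _⦋0⦌) ⟶ G) (Y : C) where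
  bot : (J.obj Y ⟶ G) → (Y ⟶ X _⦋0⦌)
  h : ∀ n : ℕ, (Y ⟶ X _⦋n⦌) → (Y ⟶ X _⦋n + 1⦌)
  map_bot : ∀ g, J.map (bot g) ≫ ε = g
  h_δ_zero : ∀ n f, h n f ≫ X.δ 0 = f
  h_δ_one : ∀ f, h 0 f ≫ X.δ 1 = bot (J.map f ≫ ε)
  h_δ_succ : ∀ n f (i : Fin (n + 2)), h (n + 1) f ≫ X.δ i.succ = h n (f ≫ X.δ i)

namespace SimplicialContraction

variable {C : Type w} [Category.{v} C] {D : Type w} [Category.{v} D]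
  {J : C ⥤ D} {X : SimplicialObject C} {G : D} {ε : J.obj (X _⦋0⦌) ⟶ G} {Y : C}

lemma map_freeHomMap_bot (H : SimplicialContraction J X ε Y)
    (g : (Free.embedding ℤ D).obj (J.obj Y) ⟶ (Free.embedding ℤ D).obj G) :
    (freeFunctor J).map (freeHomMap H.bot g) ≫ (Free.embedding ℤ D).map ε = g := by
  rw [freeFunctor_map_comp_embedding_map]
  suffices h : (freeHomMap fun f : Y ⟶ X _⦋0⦌ => J.map f ≫ ε).comp (freeHomMap H.bot) =
      AddMonoidHom.id _ from DFunLike.congr_fun h g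
  refine freeHom_addHom_ext fun g => ?_
  rw [AddMonoidHom.comp_apply, freeHomMap_embedding_map, freeHomMap_embedding_map, H.map_bot,
    AddMonoidHom.id_apply]

lemma freeHomMap_h_zero_comp_freeD (H : SimplicialContraction J X ε Y)
    (f : (Free.embedding ℤ C).obj Y ⟶ (Free.embedding ℤ C).obj (X _⦋0⦌)) :
    freeHomMap (H.h 0) f ≫ freeD X 0 =
      f - freeHomMap H.bot (freeHomMap (fun f => J.map f ≫ ε) f) := by
  suffices h : (Preadditive.rightComp _ (freeD X 0)).comp (freeHomMap (H.h 0)) =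
      AddMonoidHom.id _ - (freeHomMap H.bot).comp
        (freeHomMap fun f : Y ⟶ X _⦋0⦌ => J.map f ≫ ε) from DFunLike.congr_fun h f
  refine freeHom_addHom_ext fun f => ?_
  change freeHomMap (H.h 0) ((Free.embedding ℤ C).map f) ≫ freeD X 0 =
    (Free.embedding ℤ C).map f -
      freeHomMap H.bot (freeHomMap (fun f => J.map f ≫ ε) ((Free.embedding ℤ C).map f))
  rw [freeHomMap_embedding_map, freeHomMap_embedding_map, freeHomMap_embedding_map,
    embedding_map_comp_freeD, Fin.sum_univ_two, H.h_δ_zero, ← H.h_δ_one]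
  simp only [Fin.val_zero, pow_zero, one_smul, Fin.val_one, pow_one, neg_smul, sub_eq_add_neg]

lemma freeHomMap_h_succ_comp_freeD (H : SimplicialContraction J X ε Y) (n : ℕ)
    (f : (Free.embedding ℤ C).obj Y ⟶ (Free.embedding ℤ C).obj (X _⦋n + 1⦌)) :
    freeHomMap (H.h (n + 1)) f ≫ freeD X (n + 1) =
      f - freeHomMap (H.h n) (f ≫ freeD X n) := by
  suffices h : (Preadditive.rightComp _ (freeD X (n + 1))).comp (freeHomMap (H.h (n + 1))) =
      AddMonoidHom.id _ - (freeHomMap (H.h n)).comp (Preadditive.rightComp _ (freeD X n)) from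
    DFunLike.congr_fun h f
  refine freeHom_addHom_ext fun f => ?_
  change freeHomMap (H.h (n + 1)) ((Free.embedding ℤ C).map f) ≫ freeD X (n + 1) =
    (Free.embedding ℤ C).map f - freeHomMap (H.h n) ((Free.embedding ℤ C).map f ≫ freeD X n)
  rw [freeHomMap_embedding_map, embedding_map_comp_freeD, embedding_map_comp_freeD,
    Fin.sum_univ_succ, H.h_δ_zero, map_sum]
  simp only [H.h_δ_succ, Fin.val_zero, pow_zero, one_smul, Fin.val_succ, pow_succ, mul_neg_one,
    neg_smul, Finset.sum_neg_distrib, map_zsmul, freeHomMap_embedding_map, sub_eq_add_neg]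

lemma freeFunctor_map_freeD_zero_comp (hε : J.map (X.δ 0) ≫ ε = J.map (X.δ 1) ≫ ε) :
    (freeFunctor J).map (freeD X 0) ≫ (Free.embedding ℤ D).map ε = 0 := by
  have hd : freeD X 0 = (Free.embedding ℤ C).map (X.δ 0) - (Free.embedding ℤ C).map (X.δ 1) := by
    rw [freeD_eq_sum, Fin.sum_univ_two]
    simp only [Fin.val_zero, pow_zero, one_smul, Fin.val_one, pow_one, neg_smul, sub_eq_add_neg]
  rw [hd, Functor.map_sub, freeFunctor_map_embedding_map, freeFunctor_map_embedding_map]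
  refine (Preadditive.sub_comp _ _ _).trans (sub_eq_zero.2 ?_)
  exact ((Free.embedding ℤ D).map_comp _ _).symm.trans
    ((congrArg _ hε).trans ((Free.embedding ℤ D).map_comp _ _))

theorem relativelyExact (hε : J.map (X.δ 0) ≫ ε = J.map (X.δ 1) ≫ ε)
    (H : ∀ Y : C, SimplicialContraction J X ε Y) :
    RelativelyExact (freeFunctor J) (freeComplex X) ((Free.embedding ℤ D).map ε) where
  zero := freeFunctor_map_freeD_zero_comp hε
  surj Y g := ⟨freeHomMap (H Y).bot g, (H Y).map_freeHomMap_bot g⟩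
  exact_zero Y f hf := ⟨freeHomMap ((H Y).h 0) f,
    ((H Y).freeHomMap_h_zero_comp_freeD f).trans
      (sub_eq_self.2 ((congrArg _ ((freeFunctor_map_comp_embedding_map J ε f).symm.trans hf)).trans
        (map_zero _)))⟩
  exact_succ n Y f hf := ⟨freeHomMap ((H Y).h (n + 1)) f,
    ((H Y).freeHomMap_h_succ_comp_freeD n f).trans
      (sub_eq_self.2 ((congrArg _ hf).trans (map_zero _)))⟩

end SimplicialContraction

/-! ### Contractions from relative exactness -/

/-- A contraction of an augmented simplicial object `X ⟶ G`: extra degeneracies `h`, of which only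
the identities with the faces are required. -/
structure FaceContraction {C : Type w} [Category.{v} C] (X : SimplicialObject C) {G : C}
    (ε : X _⦋0⦌ ⟶ G) where
  bot : G ⟶ X _⦋0⦌
  h : ∀ n : ℕ, X _⦋n⦌ ⟶ X _⦋n + 1⦌
  bot_comp : bot ≫ ε = 𝟙 G
  h_δ_zero : ∀ n, h n ≫ X.δ 0 = 𝟙 _
  h_δ_one : h 0 ≫ X.δ 1 = ε ≫ bot
  h_δ_succ : ∀ n (i : Fin (n + 2)), h (n + 1) ≫ X.δ i.succ = X.δ i ≫ h n

section Filling

open Limits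

variable {C : Type w} [Category.{v} C] {X : SimplicialObject C}

/-- The face identities satisfied by the family of all faces of a simplex of dimension `m + 2`. -/
def IsCompatible {m : ℕ} {M : C} (y : Fin (m + 3) → (M ⟶ X _⦋m + 1⦌)) : Prop :=
  ∀ i j : Fin (m + 2), i ≤ j → y j.succ ≫ X.δ i = y i.castSucc ≫ X.δ j

/-- The property of `h` that makes `𝟙, X.δ 0 ≫ h, …, X.δ (n + 1) ≫ h` a compatible family of
faces, so that a contraction can be continued by `h` in dimension `n`. -/
structure IsExtraDegeneracy {n : ℕ} (h : X _⦋n⦌ ⟶ X _⦋n + 1⦌) : Prop where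
  comp_δ_zero : h ≫ X.δ 0 = 𝟙 _
  comp_δ_succ : ∀ i j : Fin (n + 1), i ≤ j →
    X.δ j.succ ≫ h ≫ X.δ i.succ = X.δ i.castSucc ≫ h ≫ X.δ j.succ

lemma IsExtraDegeneracy.isCompatible {n : ℕ} {h : X _⦋n⦌ ⟶ X _⦋n + 1⦌}
    (hh : IsExtraDegeneracy h) :
    IsCompatible (X := X) (Fin.cons (𝟙 _) fun i : Fin (n + 2) => X.δ i ≫ h) := by
  intro i j
  refine Fin.cases (fun _ => ?_) (fun i => ?_) i
  · simp [hh.comp_δ_zero]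
  · refine Fin.cases (fun hij => absurd hij (by simp)) (fun j hij => ?_) j
    rw [← Fin.succ_castSucc, Fin.cons_succ, Fin.cons_succ, Category.assoc, Category.assoc,
      hh.comp_δ_succ i j (Fin.succ_le_succ_iff.1 hij)]

lemma IsExtraDegeneracy.of_comp_δ_succ {n : ℕ} {h : X _⦋n⦌ ⟶ X _⦋n + 1⦌}
    {h' : X _⦋n + 1⦌ ⟶ X _⦋n + 2⦌} (h₀ : h' ≫ X.δ 0 = 𝟙 _)
    (h_succ : ∀ i : Fin (n + 2), h' ≫ X.δ i.succ = X.δ i ≫ h) : IsExtraDegeneracy h' where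
  comp_δ_zero := h₀
  comp_δ_succ i j hij := by
    rw [h_succ, h_succ, ← Category.assoc, ← Category.assoc, X.δ_comp_δ hij]

variable [Preadditive C]

lemma exists_filler_ge_of_filler_gt {m : ℕ} {M : C} {y : Fin (m + 3) → (M ⟶ X _⦋m + 1⦌)}
    (hy : IsCompatible y) (k : Fin (m + 2)) (x : M ⟶ X _⦋m + 2⦌)
    (hx : ∀ j, k < j → x ≫ X.δ j.succ = y j.succ) :
    ∃ x' : M ⟶ X _⦋m + 2⦌, ∀ j, k ≤ j → x' ≫ X.δ j.succ = y j.succ := by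
  refine ⟨x + (y k.succ - x ≫ X.δ k.succ) ≫ X.σ k, fun j hkj => ?_⟩
  rw [Preadditive.add_comp, Category.assoc]
  obtain rfl | hlt := hkj.eq_or_lt
  · rw [X.δ_comp_σ_succ]
    simp
  · obtain ⟨l, rfl⟩ : ∃ l : Fin (m + 1), k = l.castSucc :=
      Fin.exists_castSucc_eq.2 (hlt.trans_le (Fin.le_last j)).ne |>.imp fun _ => Eq.symm
    have hle : l.succ ≤ j := Fin.castSucc_lt_iff_succ_le.1 hlt
    have hyj := hy l.succ j hle
    have hδ := X.δ_comp_δ hle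
    rw [← Fin.succ_castSucc] at hyj hδ
    rw [X.δ_comp_σ_of_gt hlt, Preadditive.sub_comp_assoc, Category.assoc, ← hδ,
      ← Category.assoc x, hx j hlt, hyj, sub_self, zero_comp, add_zero]

lemma exists_horn_filler {m : ℕ} {M : C} {y : Fin (m + 3) → (M ⟶ X _⦋m + 1⦌)}
    (hy : IsCompatible y) :
    ∃ x : M ⟶ X _⦋m + 2⦌, ∀ j : Fin (m + 2), x ≫ X.δ j.succ = y j.succ := by
  suffices h : ∀ k : Fin (m + 2), ∃ x : M ⟶ X _⦋m + 2⦌, ∀ j, k ≤ j → x ≫ X.δ j.succ = y j.succ by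
    obtain ⟨x, hx⟩ := h 0
    exact ⟨x, fun j => hx j (Fin.zero_le j)⟩
  refine Fin.reverseInduction ?_ fun k ⟨x, hx⟩ => ?_
  · exact exists_filler_ge_of_filler_gt hy _ 0 fun j hj => absurd hj (Fin.le_last j).not_gt
  · exact exists_filler_ge_of_filler_gt hy _ x fun j hj =>
      hx j (Fin.castSucc_lt_iff_succ_le.1 hj)

lemma exists_filler_of_comp_δ_eq_zero {m : ℕ} {M : C}
    (hex : ∀ f : M ⟶ X _⦋m + 1⦌, f ≫ AlternatingFaceMapComplex.objD X m = 0 →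
      ∃ g : M ⟶ X _⦋m + 2⦌, g ≫ AlternatingFaceMapComplex.objD X (m + 1) = f)
    {z : M ⟶ X _⦋m + 1⦌} (hz : ∀ i : Fin (m + 2), z ≫ X.δ i = 0) :
    ∃ x : M ⟶ X _⦋m + 2⦌, x ≫ X.δ 0 = z ∧ ∀ j : Fin (m + 2), x ≫ X.δ j.succ = 0 := by
  obtain ⟨u, hu⟩ := hex z (by
    rw [AlternatingFaceMapComplex.objD, Preadditive.comp_sum]
    exact Finset.sum_eq_zero fun i _ => by rw [Preadditive.comp_zsmul, hz, smul_zero])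
  -- The projection to the normalized complex commutes with the differential and fixes `z`.
  let π₁ : X _⦋m + 1⦌ ⟶ X _⦋m + 1⦌ := DoldKan.PInfty.f (m + 1)
  let π₂ : X _⦋m + 2⦌ ⟶ X _⦋m + 2⦌ := DoldKan.PInfty.f (m + 2)
  have hπ : π₂ ≫ AlternatingFaceMapComplex.objD X (m + 1) =
      AlternatingFaceMapComplex.objD X (m + 1) ≫ π₁ := by
    have h := (DoldKan.PInfty : (alternatingFaceMapComplex C).obj X ⟶ _).comm (m + 2) (m + 1)
    rwa [AlternatingFaceMapComplex.obj_d_eq] at h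
  have hzπ : z ≫ π₁ = z := by
    simp only [π₁, DoldKan.PInfty_f]
    exact DoldKan.HigherFacesVanish.comp_P_eq_self fun j _ => hz _
  have hδ : ∀ j : Fin (m + 2), (u ≫ π₂) ≫ X.δ j.succ = 0 := fun j => by
    have h : π₂ ≫ X.δ j.succ = 0 := by
      simp only [π₂, DoldKan.PInfty_f]
      exact DoldKan.HigherFacesVanish.of_P (m + 2) (m + 1) j (by omega)
    rw [Category.assoc, h, comp_zero]
  refine ⟨u ≫ π₂, ?_, hδ⟩
  calc (u ≫ π₂) ≫ X.δ 0 = (u ≫ π₂) ≫ AlternatingFaceMapComplex.objD X (m + 1) := by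
        rw [AlternatingFaceMapComplex.objD, Fin.sum_univ_succ, Preadditive.comp_add,
          Preadditive.comp_sum, Finset.sum_eq_zero fun i _ => by
            rw [Preadditive.comp_zsmul, hδ, smul_zero]]
        simp
    _ = (u ≫ AlternatingFaceMapComplex.objD X (m + 1)) ≫ π₁ := by
        rw [Category.assoc, hπ, Category.assoc]
    _ = z := by rw [hu, hzπ]

lemma exists_filler {m : ℕ} {M : C}
    (hex : ∀ f : M ⟶ X _⦋m + 1⦌, f ≫ AlternatingFaceMapComplex.objD X m = 0 →
      ∃ g : M ⟶ X _⦋m + 2⦌, g ≫ AlternatingFaceMapComplex.objD X (m + 1) = f)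
    {y : Fin (m + 3) → (M ⟶ X _⦋m + 1⦌)} (hy : IsCompatible y) :
    ∃ x : M ⟶ X _⦋m + 2⦌, ∀ j : Fin (m + 3), x ≫ X.δ j = y j := by
  obtain ⟨x, hx⟩ := exists_horn_filler hy
  have hz (i : Fin (m + 2)) : (y 0 - x ≫ X.δ 0) ≫ X.δ i = 0 := by
    have hyi := hy 0 i (Fin.zero_le _)
    have hδ := X.δ_comp_δ (Fin.zero_le i)
    rw [Fin.castSucc_zero] at hyi hδ
    rw [Preadditive.sub_comp, Category.assoc, ← hyi, ← hδ, reassoc_of% hx i, sub_self]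
  obtain ⟨x', hx'₀, hx'⟩ := exists_filler_of_comp_δ_eq_zero hex hz
  refine ⟨x + x', Fin.cases ?_ fun j => ?_⟩
  · rw [Preadditive.add_comp, hx'₀, add_sub_cancel]
  · rw [Preadditive.add_comp, hx', hx, add_zero]

end Filling

namespace RelativelyExact

open Limits

variable {C : Type w} [Category.{v} C] [Preadditive C] {X : SimplicialObject C} {G : C}
  {ε : X _⦋0⦌ ⟶ G}

lemma δ_zero_comp_eq (H : RelativelyExact (𝟭 C) ((alternatingFaceMapComplex C).obj X) ε) :
    X.δ 0 ≫ ε = X.δ 1 ≫ ε := by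
  have h : ((alternatingFaceMapComplex C).obj X).d 1 0 ≫ ε = 0 := H.zero
  rwa [alternatingFaceMapComplex_d_one_zero, Preadditive.sub_comp, sub_eq_zero] at h

lemma exists_h_zero (H : RelativelyExact (𝟭 C) ((alternatingFaceMapComplex C).obj X) ε)
    {b : G ⟶ X _⦋0⦌} (hb : b ≫ ε = 𝟙 G) :
    ∃ h : X _⦋0⦌ ⟶ X _⦋1⦌, h ≫ X.δ 0 = 𝟙 _ ∧ h ≫ X.δ 1 = ε ≫ b := by
  obtain ⟨u, hu⟩ : ∃ u : X _⦋0⦌ ⟶ X _⦋1⦌, u ≫ (X.δ 0 - X.δ 1) = 𝟙 _ - ε ≫ b := by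
    rw [← alternatingFaceMapComplex_d_one_zero]
    refine H.exact_zero (X _⦋0⦌) (𝟙 (X _⦋0⦌) - ε ≫ b) ?_
    change (𝟙 (X _⦋0⦌) - ε ≫ b) ≫ ε = 0
    rw [Preadditive.sub_comp, Category.id_comp, Category.assoc, hb, Category.comp_id, sub_self]
  have hσ₀ : X.σ 0 ≫ X.δ 0 = 𝟙 (X _⦋0⦌) := X.δ_comp_σ_self (i := (0 : Fin 1))
  have hσ₁ : X.σ 0 ≫ X.δ 1 = 𝟙 (X _⦋0⦌) := X.δ_comp_σ_succ (i := (0 : Fin 1))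
  rw [Preadditive.comp_sub] at hu
  refine ⟨u + (ε ≫ b - u ≫ X.δ 1) ≫ X.σ 0, ?_, ?_⟩
  · rw [Preadditive.add_comp, Category.assoc, hσ₀, Category.comp_id, add_sub_left_comm, hu]
    abel
  · rw [Preadditive.add_comp, Category.assoc, hσ₁, Category.comp_id, add_sub_cancel]

lemma exists_h_succ (H : RelativelyExact (𝟭 C) ((alternatingFaceMapComplex C).obj X) ε) {n : ℕ}
    {h : X _⦋n⦌ ⟶ X _⦋n + 1⦌} (hh : IsExtraDegeneracy h) :
    ∃ h' : X _⦋n + 1⦌ ⟶ X _⦋n + 2⦌, IsExtraDegeneracy h' ∧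
      ∀ i : Fin (n + 2), h' ≫ X.δ i.succ = X.δ i ≫ h := by
  have hex := H.exact_succ n (X _⦋n + 1⦌)
  simp only [alternatingFaceMapComplex_obj_d] at hex
  obtain ⟨h', hδ⟩ := exists_filler hex hh.isCompatible
  have h_succ (i : Fin (n + 2)) : h' ≫ X.δ i.succ = X.δ i ≫ h := by rw [hδ, Fin.cons_succ]
  exact ⟨h', .of_comp_δ_succ (by rw [hδ, Fin.cons_zero]) h_succ, h_succ⟩

theorem nonempty_faceContraction
    (H : RelativelyExact (𝟭 C) ((alternatingFaceMapComplex C).obj X) ε) :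
    Nonempty (FaceContraction X ε) := by
  obtain ⟨b, hb⟩ : ∃ b : G ⟶ X _⦋0⦌, b ≫ ε = 𝟙 G := H.surj G (𝟙 G)
  obtain ⟨h₀, h₀₀, h₀₁⟩ := H.exists_h_zero hb
  have extra₀ : IsExtraDegeneracy h₀ := by
    refine ⟨h₀₀, fun i j _ => ?_⟩
    obtain rfl := Fin.fin_one_eq_zero i
    obtain rfl := Fin.fin_one_eq_zero j
    rw [Fin.succ_zero_eq_one, Fin.castSucc_zero, h₀₁, ← Category.assoc, ← H.δ_zero_comp_eq,
      Category.assoc]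
  choose next h_extra h_succ using
    fun n (h : {h : X _⦋n⦌ ⟶ X _⦋n + 1⦌ // IsExtraDegeneracy h}) => H.exists_h_succ h.2
  let seq (n : ℕ) : {h : X _⦋n⦌ ⟶ X _⦋n + 1⦌ // IsExtraDegeneracy h} :=
    Nat.rec ⟨h₀, extra₀⟩ (fun n h => ⟨next n h, h_extra n h⟩) n
  exact ⟨⟨b, fun n => (seq n).1, hb, fun n => (seq n).2.comp_δ_zero, h₀₁,
    fun n => h_succ n (seq n)⟩⟩

end RelativelyExact

/-! ### Differential graded Lie algebras -/

namespace RatComplex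

lemma map_d {K L : RatComplex.{u}} (φ : K ⟶ L) (i j : ℕ) (x : K.X i) :
    (φ.f j).hom ((K.d i j).hom x) = (L.d i j).hom ((φ.f i).hom x) :=
  (congrArg (fun g => g.hom x) (φ.comm i j)).symm

lemma d_d (K : RatComplex.{u}) (i j k : ℕ) (x : K.X i) :
    (K.d j k).hom ((K.d i j).hom x) = 0 :=
  congrArg (fun g => g.hom x) (K.d_comp_d i j k)

lemma d_apply_zero (K : RatComplex.{u}) (x : K.X 0) : (K.d 0 (0 - 1)).hom x = 0 :=
  congrArg (fun g => g.hom x) (K.shape 0 (0 - 1) (by simp))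

end RatComplex

namespace DGL

/-- A chain complex as an abelian DGL, with zero bracket; this also lets the explicit cycles,
boundaries and homology of DGLs be used for chain complexes. -/
abbrev triv (V : RatComplex.{u}) : DGL.{u} where
  X := V
  bracket _ _ _ := 0
  bracket_shape _ _ _ _ := rfl
  bracket_symm _ _ _ _ _ := by simp
  jacobi _ _ _ _ _ _ := by simp
  d_bracket _ _ _ _ _ _ := by simp

@[ext]
lemma hom_ext {K L : DGL.{u}} {F G : K ⟶ L}
    (h : ∀ n (x : K.X.X n), ((Hom.f F).f n).hom x = ((Hom.f G).f n).hom x) : F = G := by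
  apply Hom.ext
  ext n x
  exact h n x

lemma comp_apply {K L M : DGL.{u}} (F : K ⟶ L) (G : L ⟶ M) (n : ℕ) (x : K.X.X n) :
    ((Hom.f (F ≫ G)).f n).hom x = ((Hom.f G).f n).hom (((Hom.f F).f n).hom x) := rfl

/-- The map induced on cycles by a chain map. -/
def cycMap {K L : DGL.{u}} (φ : K.X ⟶ L.X) (n : ℕ) : K.cyc n →ₗ[ℚ] L.cyc n :=
  (φ.f n).hom.restrict fun x (hx : (K.X.d n (n - 1)).hom x = 0) => by
    change (L.X.d n (n - 1)).hom _ = 0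
    rw [← RatComplex.map_d, hx, map_zero]

/-- The homology class of a cycle. -/
def cls (K : DGL.{u}) (n : ℕ) : K.cyc n →ₗ[ℚ] K.Hmod n := Submodule.mkQ _

lemma cls_surjective (K : DGL.{u}) (n : ℕ) : Function.Surjective (K.cls n) :=
  Submodule.mkQ_surjective _

lemma cls_eq_zero_iff (K : DGL.{u}) (n : ℕ) (x : K.cyc n) :
    K.cls n x = 0 ↔ (x : K.X.X n) ∈ K.bdry n :=
  Submodule.Quotient.mk_eq_zero _

lemma cls_eq_iff (K : DGL.{u}) (n : ℕ) (x y : K.cyc n) :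
    K.cls n x = K.cls n y ↔ (x : K.X.X n) - y ∈ K.bdry n :=
  Submodule.Quotient.eq _

/-- The map induced on homology by a chain map. -/
def Hmap {K L : DGL.{u}} (φ : K.X ⟶ L.X) (n : ℕ) : K.Hmod n →ₗ[ℚ] L.Hmod n :=
  Submodule.mapQ _ _ (cycMap φ n) (by
    rintro x ⟨y, hy⟩
    refine ⟨(φ.f (n + 1)).hom y, ?_⟩
    rw [← RatComplex.map_d, hy]
    rfl)

lemma Hmod_ext {K : DGL.{u}} {n : ℕ} {M : Type*} [AddCommGroup M] [Module ℚ M]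
    {f g : K.Hmod n →ₗ[ℚ] M} (h : ∀ x : K.cyc n, f (K.cls n x) = g (K.cls n x)) : f = g := by
  apply Submodule.linearMap_qext
  ext x
  exact h x

lemma Hmap_eq_iff {K L : DGL.{u}} {φ ψ : K.X ⟶ L.X} {n : ℕ} :
    Hmap φ n = Hmap ψ n ↔ ∀ x : K.cyc n, (φ.f n).hom x.1 - (ψ.f n).hom x.1 ∈ L.bdry n :=
  ⟨fun h x => (L.cls_eq_iff n _ _).1 (LinearMap.congr_fun h (K.cls n x)),
    fun h => Hmod_ext fun x => (L.cls_eq_iff n _ _).2 (h x)⟩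

/-- The functor `L ↦ (H_*(L), 0)`. -/
def homologyDGLFunctor : DGL.{u} ⥤ DGL.{u} where
  obj K := K.homologyDGL
  map {K L} F :=
    { f :=
        { f := fun n => ModuleCat.ofHom (Hmap (Hom.f F) n)
          comm' := fun _ _ _ => Limits.comp_zero.trans Limits.zero_comp.symm }
      map_bracket := fun p q r x y => by
        obtain ⟨x, rfl⟩ := K.cls_surjective p x
        obtain ⟨y, rfl⟩ := K.cls_surjective q y
        refine congrArg (L.cls r) (Subtype.ext ?_)
        exact Hom.map_bracket F p q r x y }
  map_id K := hom_ext fun n x => by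
    obtain ⟨x, rfl⟩ := K.cls_surjective n x
    rfl
  map_comp {K L M} F G := hom_ext fun n x => by
    obtain ⟨x, rfl⟩ := K.cls_surjective n x
    rfl

lemma homologyDGLFunctor_map_eq_iff {K L : DGL.{u}} (F G : K ⟶ L) :
    homologyDGLFunctor.map F = homologyDGLFunctor.map G ↔
      ∀ n, Hmap (Hom.f F) n = Hmap (Hom.f G) n := by
  constructor
  · intro h n
    refine LinearMap.ext fun x => ?_
    exact congrArg (fun F : K.homologyDGL ⟶ L.homologyDGL => ((Hom.f F).f n).hom x) h
  · intro h
    exact hom_ext fun n x => congrArg (fun f => f x) (h n)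

/-- The cycles of a DGL, as a DGL with zero differential. -/
def cyclesDGL (K : DGL.{u}) : DGL.{u} where
  X := { X := fun n => ModuleCat.of ℚ (K.cyc n), d := fun _ _ => 0 }
  bracket p q r := K.cycBracket p q r
  bracket_shape p q r h := by
    ext x y : 3
    change K.bracket p q r x y = 0
    rw [K.bracket_shape p q r h]
    rfl
  bracket_symm p q r x y := Subtype.ext (K.bracket_symm p q r x y)
  jacobi p q r x y z := Subtype.ext (K.jacobi p q r x y z)
  d_bracket p q r _ x y := by
    change (0 : K.cyc (r - 1)) = K.cycBracket (p - 1) q (r - 1) 0 y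
      + (-1 : ℚ) ^ p • K.cycBracket p (q - 1) (r - 1) x 0
    simp

/-- The inclusion of cycles. -/
def cyclesIncl (K : DGL.{u}) : K.cyclesDGL ⟶ K where
  f :=
    { f := fun n => ModuleCat.ofHom (K.cyc n).subtype
      comm' := fun i j h => by
        obtain rfl : j = i - 1 := by simp at h; omega
        ext x
        exact x.2 }
  map_bracket _ _ _ _ _ := rfl

/-- The projection from cycles to homology. -/
def cyclesProj (K : DGL.{u}) : K.cyclesDGL ⟶ K.homologyDGL where
  f :=
    { f := fun n => ModuleCat.ofHom (K.cls n)
      comm' := fun _ _ _ => Limits.comp_zero.trans Limits.zero_comp.symm }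
  map_bracket _ _ _ _ _ := rfl

/-- The projection to the abelianization. -/
def abProj (K : DGL.{u}) : K ⟶ triv (ab.obj K) where
  f :=
    { f := fun n => ModuleCat.ofHom (K.decomposables n).mkQ
      comm' := fun _ _ _ => rfl }
  map_bracket _ _ _ _ _ :=
    (Submodule.Quotient.mk_eq_zero _).2 (Submodule.subset_span ⟨_, _, _, _, rfl⟩)

/-- The comparison from the explicit cycles to Mathlib's object of cycles. -/
def cycToCycles (K : DGL.{u}) (n : ℕ) : ModuleCat.of ℚ (K.cyc n) ⟶ K.X.cycles n :=
  K.X.liftCycles (ModuleCat.ofHom (K.cyc n).subtype) (n - 1) (by cases n <;> simp)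
    (by ext x; exact x.2)

lemma iCycles_cycToCycles (K : DGL.{u}) (n : ℕ) (x : K.cyc n) :
    (K.X.iCycles n).hom ((K.cycToCycles n).hom x) = x :=
  congrArg (fun g => g.hom x) (K.X.liftCycles_i (ModuleCat.ofHom (K.cyc n).subtype) (n - 1)
    (by cases n <;> simp) (by ext x; exact x.2))

lemma iCycles_injective (K : DGL.{u}) (n : ℕ) : Function.Injective (K.X.iCycles n).hom :=
  (ModuleCat.mono_iff_injective (K.X.iCycles n)).1 inferInstance

/-- The class of an explicit cycle in Mathlib's homology object. -/
def cycToHomology (K : DGL.{u}) (n : ℕ) : ModuleCat.of ℚ (K.cyc n) ⟶ K.X.homology n :=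
  K.cycToCycles n ≫ K.X.homologyπ n

lemma cycToHomology_surjective (K : DGL.{u}) (n : ℕ) :
    Function.Surjective (K.cycToHomology n).hom := by
  intro y
  obtain ⟨c, rfl⟩ := (ModuleCat.epi_iff_surjective (K.X.homologyπ n)).1 inferInstance y
  have hc : (K.X.iCycles n).hom c ∈ K.cyc n := by
    have h := K.X.iCycles_d n (n - 1)
    exact congrArg (fun g => g.hom c) h
  refine ⟨⟨_, hc⟩, ?_⟩
  exact congrArg (K.X.homologyπ n).hom (K.iCycles_injective n (K.iCycles_cycToCycles n ⟨_, hc⟩))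

lemma cycToHomology_eq_zero_iff (K : DGL.{u}) (n : ℕ) (x : K.cyc n) :
    (K.cycToHomology n).hom x = 0 ↔ (x : K.X.X n) ∈ K.bdry n := by
  have hex : (ShortComplex.mk _ _ (K.X.toCycles_comp_homologyπ (n + 1) n)).Exact :=
    ShortComplex.exact_of_g_is_cokernel _ (K.X.homologyIsCokernel (n + 1) n (by simp))
  have hz : ∀ y, (K.X.homologyπ n).hom ((K.X.toCycles (n + 1) n).hom y) = 0 := fun y =>
    congrArg (fun g => g.hom y) (K.X.toCycles_comp_homologyπ (n + 1) n)
  have hi : ∀ y, (K.X.iCycles n).hom ((K.X.toCycles (n + 1) n).hom y) = (K.X.d (n + 1) n).hom y :=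
    fun y => congrArg (fun g => g.hom y) (K.X.toCycles_i (n + 1) n)
  constructor
  · intro h
    obtain ⟨y, hy⟩ := (ShortComplex.moduleCat_exact_iff _).1 hex _ h
    refine ⟨y, (hi y).symm.trans ?_⟩
    exact (congrArg (K.X.iCycles n).hom hy).trans (K.iCycles_cycToCycles n x)
  · rintro ⟨y, hy⟩
    refine Eq.trans (congrArg (K.X.homologyπ n).hom ?_) (hz y)
    apply K.iCycles_injective n
    exact (K.iCycles_cycToCycles n x).trans (hy.symm.trans (hi y).symm)

/-- The comparison from the explicit homology to Mathlib's homology object. -/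
def toHomology (K : DGL.{u}) (n : ℕ) : K.Hmod n →ₗ[ℚ] (K.X.homology n : Type u) :=
  Submodule.liftQ _ (K.cycToHomology n).hom fun x hx => (K.cycToHomology_eq_zero_iff n x).2 hx

lemma toHomology_bijective (K : DGL.{u}) (n : ℕ) : Function.Bijective (toHomology K n) := by
  refine ⟨(injective_iff_map_eq_zero _).2 fun x hx => ?_, fun y => ?_⟩
  · obtain ⟨x, rfl⟩ := K.cls_surjective n x
    exact (cls_eq_zero_iff K n x).2 ((K.cycToHomology_eq_zero_iff n x).1 hx)
  · obtain ⟨x, rfl⟩ := K.cycToHomology_surjective n y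
    exact ⟨K.cls n x, rfl⟩

lemma homologyMap_toHomology {K L : DGL.{u}} (φ : K.X ⟶ L.X) (n : ℕ) (x : K.Hmod n) :
    (HomologicalComplex.homologyMap φ n).hom (toHomology K n x) =
      toHomology L n (Hmap φ n x) := by
  obtain ⟨x, rfl⟩ := K.cls_surjective n x
  have h : K.cycToHomology n ≫ HomologicalComplex.homologyMap φ n =
      ModuleCat.ofHom (cycMap φ n) ≫ L.cycToHomology n := by
    rw [cycToHomology, cycToHomology, cycToCycles, cycToCycles, Category.assoc,
      HomologicalComplex.homologyπ_naturality,
      HomologicalComplex.liftCycles_comp_cyclesMap_assoc, ← Category.assoc (ModuleCat.ofHom _),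
      HomologicalComplex.comp_liftCycles]
    rfl
  exact congrArg (fun g => g.hom x) h

lemma isIso_homologyMap_iff {K L : DGL.{u}} (φ : K.X ⟶ L.X) (n : ℕ) :
    IsIso (HomologicalComplex.homologyMap φ n) ↔ Function.Bijective (Hmap φ n) := by
  rw [ConcreteCategory.isIso_iff_bijective]
  have h : (HomologicalComplex.homologyMap φ n).hom ∘ toHomology K n =
      toHomology L n ∘ Hmap φ n := funext (homologyMap_toHomology φ n)
  rw [← (toHomology_bijective L n).of_comp_iff', ← h]
  exact ((toHomology_bijective K n).of_comp_iff _).symm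

end DGL

/-! ### Splittings of rational complexes -/

lemma exists_linearMap_comp_comp_self {k V W : Type*} [Field k] [AddCommGroup V] [Module k V]
    [AddCommGroup W] [Module k W] (f : V →ₗ[k] W) : ∃ g : W →ₗ[k] V, ∀ x, f (g (f x)) = f x := by
  obtain ⟨s, hs⟩ := f.rangeRestrict.exists_rightInverse_of_surjective f.range_rangeRestrict
  obtain ⟨g, hg⟩ := LinearMap.exists_extend s
  refine ⟨g, fun x => ?_⟩
  have hgs : g (f x) = s (f.rangeRestrict x) := congrArg (fun t => t (f.rangeRestrict x)) hg
  have hsection : f.rangeRestrict (s (f.rangeRestrict x)) = f.rangeRestrict x :=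
    congrArg (fun t => t (f.rangeRestrict x)) hs
  rw [hgs]
  exact congrArg Subtype.val hsection

/-- A splitting of a complex: a choice of pseudo-inverses of the differentials. -/
structure RatComplex.Splitting (V : RatComplex.{u}) where
  h : HomFamily V V
  d_h_d : ∀ i j x, (V.d j i).hom (h i j ((V.d j i).hom x)) = (V.d j i).hom x

namespace RatComplex.Splitting

instance (V : RatComplex.{u}) : Nonempty (Splitting V) := by
  choose h hh using fun i j => exists_linearMap_comp_comp_self (V.d j i).hom
  exact ⟨⟨h, hh⟩⟩

variable {V : RatComplex.{u}} (S : Splitting V)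

/-- The null-homotopic chain map `∂ h + h ∂`. -/
def null (n : ℕ) : V.X n →ₗ[ℚ] V.X n :=
  (V.d (n + 1) n).hom ∘ₗ S.h n (n + 1) + S.h (n - 1) n ∘ₗ (V.d n (n - 1)).hom

/-- The projection `1 - ∂ h - h ∂` to a space of representatives of the homology. -/
def proj (n : ℕ) : V.X n →ₗ[ℚ] V.X n := LinearMap.id - S.null n

lemma proj_apply (n : ℕ) (x : V.X n) : S.proj n x = x - S.null n x := rfl

lemma null_apply (n : ℕ) (x : V.X n) : S.null n x =
    (V.d (n + 1) n).hom (S.h n (n + 1) x) + S.h (n - 1) n ((V.d n (n - 1)).hom x) := rfl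

lemma d_proj (n m : ℕ) (x : V.X n) : (V.d n m).hom (S.proj n x) = 0 := by
  by_cases h : m + 1 = n
  · obtain rfl : m = n - 1 := by omega
    rw [proj_apply, null_apply, map_sub, map_add, RatComplex.d_d, S.d_h_d, zero_add, sub_self]
  · rw [V.shape n m (by simpa using h)]
    rfl

lemma proj_d (n m : ℕ) (x : V.X m) : S.proj n ((V.d m n).hom x) = 0 := by
  by_cases h : n + 1 = m
  · subst h
    rw [proj_apply, null_apply, S.d_h_d, RatComplex.d_d, map_zero, add_zero, sub_self]
  · rw [V.shape m n (by simpa using h)]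
    exact map_zero _

lemma proj_sub_self_mem (n : ℕ) (c : (DGL.triv V).cyc n) :
    S.proj n c.1 - c.1 ∈ (DGL.triv V).bdry n := by
  have hc : (V.d n (n - 1)).hom c.1 = 0 := c.2
  rw [proj_apply, null_apply, hc, map_zero, add_zero, sub_sub_cancel_left]
  exact Submodule.neg_mem _ ⟨_, rfl⟩

/-- The projection, with values in the cycles. -/
def projCyc (n : ℕ) : V.X n →ₗ[ℚ] (DGL.triv V).cyc n :=
  (S.proj n).codRestrict _ fun x => S.d_proj n (n - 1) x

lemma cls_projCyc (n : ℕ) (c : (DGL.triv V).cyc n) :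
    (DGL.triv V).cls n (S.projCyc n c.1) = (DGL.triv V).cls n c :=
  (DGL.cls_eq_iff _ _ _ _).2 (S.proj_sub_self_mem n c)

/-- Maps on cycles, precomposed with the projection to cycles, as a chain map: it vanishes on
boundaries, and so commutes with the differentials. -/
def chainMap {W : DGL.{u}} (g : ∀ n, (DGL.triv V).cyc n →ₗ[ℚ] W.cyc n) : V ⟶ W.cyclesDGL.X where
  f n := ModuleCat.ofHom (g n ∘ₗ S.projCyc n)
  comm' i j _ := by
    refine Limits.comp_zero.trans (ModuleCat.hom_ext (LinearMap.ext fun x => ?_))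
    have h : S.projCyc j ((V.d i j).hom x) = 0 := Subtype.ext (S.proj_d _ _ x)
    exact ((congrArg (g j) h).trans (map_zero _)).symm

end RatComplex.Splitting

namespace DGL

namespace IsFreeOn

variable {V : RatComplex.{u}} {Y : DGL.{u}} {ι : V ⟶ Y.X}

lemma exists_extension (hι : IsFreeOn (L := Y) ι) {K : DGL.{u}} (g : V ⟶ K.X) :
    ∃ F : Y ⟶ K, ∀ n v, ((Hom.f F).f n).hom ((ι.f n).hom v) = (g.f n).hom v := by
  obtain ⟨F, hF, -⟩ := hι K g
  exact ⟨F, fun n v => congrArg (fun g : V ⟶ K.X => (g.f n).hom v) hF⟩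

lemma hom_ext (hι : IsFreeOn (L := Y) ι) {K : DGL.{u}} {F G : Y ⟶ K}
    (h : ∀ n v, ((Hom.f F).f n).hom ((ι.f n).hom v) = ((Hom.f G).f n).hom ((ι.f n).hom v)) :
    F = G := by
  refine (hι K (ι ≫ toComplex.map G)).unique ?_ rfl
  ext n v
  exact h n v

end IsFreeOn

lemma exists_cls_section (K : DGL.{u}) (n : ℕ) :
    ∃ s : K.Hmod n →ₗ[ℚ] K.cyc n, ∀ x, K.cls n (s x) = x := by
  obtain ⟨s, hs⟩ := (K.cls n).exists_rightInverse_of_surjective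
    (LinearMap.range_eq_top.2 (K.cls_surjective n))
  exact ⟨s, LinearMap.congr_fun hs⟩

theorem IsFreeOn.exists_hom_Hmap_eq {V : RatComplex.{u}} {Y : DGL.{u}} {ι : V ⟶ Y.X}
    (hι : IsFreeOn (L := Y) ι) (Z : DGL.{u}) (l : ∀ n, (triv V).Hmod n →ₗ[ℚ] Z.Hmod n) :
    ∃ F : Y ⟶ Z, ∀ n, Hmap (Hom.f F) n ∘ₗ Hmap (K := triv V) ι n = l n := by
  obtain ⟨S⟩ := (inferInstance : Nonempty (RatComplex.Splitting V))
  choose s hs using Z.exists_cls_section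
  obtain ⟨F, hF⟩ := hι.exists_extension (S.chainMap fun n => s n ∘ₗ l n ∘ₗ (triv V).cls n)
  refine ⟨F ≫ Z.cyclesIncl, fun n => Hmod_ext fun c => ?_⟩
  calc Z.cls n (cycMap (Hom.f (F ≫ Z.cyclesIncl)) n (cycMap (K := triv V) ι n c))
      = Z.cls n (s n (l n ((triv V).cls n (S.projCyc n c.1)))) :=
        congrArg (Z.cls n) (Subtype.ext (congrArg Subtype.val (hF n c.1)))
    _ = l n ((triv V).cls n c) := by rw [hs, S.cls_projCyc]

end DGL

/-! ### Extension of scalars -/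

namespace DGL

section BaseChange

open scoped TensorProduct

variable (K : DGL.{u}) (R : Type) [CommRing R] [Algebra ℚ R]

/-- The bracket on `K ⊗ R`. -/
def tensorBracket (p q r : ℕ) : K.X.X p ⊗[ℚ] R →ₗ[ℚ] K.X.X q ⊗[ℚ] R →ₗ[ℚ] K.X.X r ⊗[ℚ] R :=
  TensorProduct.map₂ (K.bracket p q r) (LinearMap.mul ℚ R)

variable {R}

lemma tensorBracket_tmul (p q r : ℕ) (x : K.X.X p) (f : R) (y : K.X.X q) (g : R) :
    K.tensorBracket R p q r (x ⊗ₜ f) (y ⊗ₜ g) = K.bracket p q r x y ⊗ₜ[ℚ] (f * g) := rfl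

lemma tensorBracket_shape (p q r : ℕ) (h : p + q ≠ r) : K.tensorBracket R p q r = 0 := by
  apply TensorProduct.ext'
  intro x f
  apply TensorProduct.ext'
  intro y g
  rw [tensorBracket_tmul, K.bracket_shape p q r h]
  exact TensorProduct.zero_tmul _ _

lemma tensorBracket_symm (p q r : ℕ) (x : K.X.X p ⊗[ℚ] R) (y : K.X.X q ⊗[ℚ] R) :
    K.tensorBracket R p q r x y = (-1 : ℚ) ^ (p * q + 1) • K.tensorBracket R q p r y x := by
  induction x using TensorProduct.induction_on with
  | zero => simp
  | add x x' hx hx' => simp only [map_add, LinearMap.add_apply, hx, hx', smul_add]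
  | tmul x f =>
    induction y using TensorProduct.induction_on with
    | zero => simp
    | add y y' hy hy' => simp only [map_add, LinearMap.add_apply, hy, hy', smul_add]
    | tmul y g =>
      rw [tensorBracket_tmul, tensorBracket_tmul, TensorProduct.smul_tmul', ← K.bracket_symm,
        mul_comm]

lemma tensorBracket_jacobi (p q r : ℕ) (x : K.X.X p ⊗[ℚ] R) (y : K.X.X q ⊗[ℚ] R)
    (z : K.X.X r ⊗[ℚ] R) :
    (-1 : ℚ) ^ (p * r) •
        K.tensorBracket R (p + q) r (p + q + r) (K.tensorBracket R p q (p + q) x y) z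
      + (-1 : ℚ) ^ (q * p) •
        K.tensorBracket R (q + r) p (p + q + r) (K.tensorBracket R q r (q + r) y z) x
      + (-1 : ℚ) ^ (r * q) •
        K.tensorBracket R (r + p) q (p + q + r) (K.tensorBracket R r p (r + p) z x) y = 0 := by
  induction x using TensorProduct.induction_on with
  | zero => simp
  | add x x' hx hx' =>
    simp only [map_add, LinearMap.add_apply, smul_add]
    linear_combination (norm := module) hx + hx'
  | tmul x f =>
    induction y using TensorProduct.induction_on with
    | zero => simp
    | add y y' hy hy' =>
      simp only [map_add, LinearMap.add_apply, smul_add]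
      linear_combination (norm := module) hy + hy'
    | tmul y g =>
      induction z using TensorProduct.induction_on with
      | zero => simp
      | add z z' hz hz' =>
        simp only [map_add, LinearMap.add_apply, smul_add]
        linear_combination (norm := module) hz + hz'
      | tmul z h =>
        simp only [tensorBracket_tmul, TensorProduct.smul_tmul']
        rw [show g * h * f = f * g * h by ring, show h * f * g = f * g * h by ring,
          ← TensorProduct.add_tmul, ← TensorProduct.add_tmul, K.jacobi, TensorProduct.zero_tmul]

lemma tensorBracket_d (p q r : ℕ) (hr : p + q = r) (x : K.X.X p ⊗[ℚ] R) (y : K.X.X q ⊗[ℚ] R) :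
    LinearMap.rTensor R (K.X.d r (r - 1)).hom (K.tensorBracket R p q r x y)
      = K.tensorBracket R (p - 1) q (r - 1) (LinearMap.rTensor R (K.X.d p (p - 1)).hom x) y
        + (-1 : ℚ) ^ p • K.tensorBracket R p (q - 1) (r - 1) x
          (LinearMap.rTensor R (K.X.d q (q - 1)).hom y) := by
  induction x using TensorProduct.induction_on with
  | zero => simp
  | add x x' hx hx' =>
    simp only [map_add, LinearMap.add_apply, smul_add]
    rw [hx, hx']
    abel
  | tmul x f =>
    induction y using TensorProduct.induction_on with
    | zero => simp
    | add y y' hy hy' =>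
      simp only [map_add, smul_add]
      rw [hy, hy']
      abel
    | tmul y g =>
      simp only [tensorBracket_tmul, LinearMap.rTensor_tmul]
      rw [K.d_bracket p q r hr, TensorProduct.add_tmul, TensorProduct.smul_tmul']

variable (R)

/-- The DGL `K ⊗ R` over `ℚ`, for a commutative algebra `R`. -/
def baseChange : DGL.{u} where
  X :=
    { X := fun n => ModuleCat.of ℚ (K.X.X n ⊗[ℚ] R)
      d := fun i j => ModuleCat.ofHom (LinearMap.rTensor R (K.X.d i j).hom)
      shape := fun i j h => by
        rw [K.X.shape i j h, ModuleCat.hom_zero, LinearMap.rTensor_zero]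
        rfl
      d_comp_d' := fun i j k _ _ => by
        rw [← ModuleCat.ofHom_comp, ← LinearMap.rTensor_comp, ← ModuleCat.hom_comp, K.X.d_comp_d,
          ModuleCat.hom_zero, LinearMap.rTensor_zero]
        rfl }
  bracket p q r := K.tensorBracket R p q r
  bracket_shape p q r h := K.tensorBracket_shape p q r h
  bracket_symm p q r x y := K.tensorBracket_symm p q r x y
  jacobi p q r x y z := K.tensorBracket_jacobi p q r x y z
  d_bracket p q r hr x y := K.tensorBracket_d p q r hr x y

variable {R}

/-- The map `K ⊗ R ⟶ K` induced by an augmentation of `R`. -/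
def tensorEval (ev : R →ₗ[ℚ] ℚ) (n : ℕ) : K.X.X n ⊗[ℚ] R →ₗ[ℚ] K.X.X n :=
  (TensorProduct.rid ℚ (K.X.X n)).toLinearMap ∘ₗ LinearMap.lTensor _ ev

lemma tensorEval_tmul (ev : R →ₗ[ℚ] ℚ) (n : ℕ) (x : K.X.X n) (f : R) :
    K.tensorEval ev n (x ⊗ₜ f) = ev f • x := rfl

lemma tensorEval_d (ev : R →ₗ[ℚ] ℚ) (i j : ℕ) (x : K.X.X i ⊗[ℚ] R) :
    K.tensorEval ev j (LinearMap.rTensor R (K.X.d i j).hom x) =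
      (K.X.d i j).hom (K.tensorEval ev i x) := by
  induction x using TensorProduct.induction_on with
  | zero => simp
  | add x x' hx hx' => simp only [map_add, hx, hx']
  | tmul x f => rw [LinearMap.rTensor_tmul, tensorEval_tmul, tensorEval_tmul, map_smul]

lemma tensorEval_bracket (ev : R →ₐ[ℚ] ℚ) (p q r : ℕ) (x : K.X.X p ⊗[ℚ] R)
    (y : K.X.X q ⊗[ℚ] R) : K.tensorEval ev.toLinearMap r (K.tensorBracket R p q r x y) =
      K.bracket p q r (K.tensorEval ev.toLinearMap p x) (K.tensorEval ev.toLinearMap q y) := by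
  induction x using TensorProduct.induction_on with
  | zero => simp
  | add x x' hx hx' => simp only [map_add, LinearMap.add_apply, hx, hx']
  | tmul x f =>
    induction y using TensorProduct.induction_on with
    | zero => simp
    | add y y' hy hy' => simp only [map_add, hy, hy']
    | tmul y g =>
      rw [tensorBracket_tmul, tensorEval_tmul, tensorEval_tmul, tensorEval_tmul]
      simp only [AlgHom.toLinearMap_apply]
      rw [map_mul, map_smul, LinearMap.map_smul₂, smul_smul, mul_comm]

/-- The map `K ⊗ R ⟶ K` of DGLs induced by an augmentation of `R`. -/
def baseChangeEval (ev : R →ₐ[ℚ] ℚ) : K.baseChange R ⟶ K where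
  f :=
    { f := fun n => ModuleCat.ofHom (K.tensorEval ev.toLinearMap n)
      comm' := fun i j _ => by
        ext x
        exact (K.tensorEval_d ev.toLinearMap i j x).symm }
  map_bracket p q r x y := K.tensorEval_bracket ev p q r x y

end BaseChange

/-! ### The path object of a DGL with a derivation -/

lemma d_bracket_zero_left (K : DGL.{u}) (q : ℕ) (x : K.X.X 0) (y : K.X.X (q + 1)) :
    (K.X.d (q + 1) q).hom (K.bracket 0 (q + 1) (q + 1) x y) =
      K.bracket 0 q q x ((K.X.d (q + 1) q).hom y) := by
  have h := K.d_bracket 0 (q + 1) (q + 1) (by omega) x y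
  rw [RatComplex.d_apply_zero, LinearMap.map_zero₂, pow_zero, one_smul, zero_add] at h
  exact h

lemma d_bracket_zero_right (K : DGL.{u}) (p : ℕ) (x : K.X.X (p + 1)) (y : K.X.X 0) :
    (K.X.d (p + 1) p).hom (K.bracket (p + 1) 0 (p + 1) x y) =
      K.bracket p 0 p ((K.X.d (p + 1) p).hom x) y := by
  have h := K.d_bracket (p + 1) 0 (p + 1) (by omega) x y
  rw [RatComplex.d_apply_zero, map_zero, smul_zero, add_zero] at h
  exact h

lemma jacobi_of_eq (K : DGL.{u}) {p q r a b c s : ℕ} (ha : p + q = a) (hb : q + r = b)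
    (hc : r + p = c) (hs : p + q + r = s) (x : K.X.X p) (y : K.X.X q) (z : K.X.X r) :
    (-1 : ℚ) ^ (p * r) • K.bracket a r s (K.bracket p q a x y) z
      + (-1 : ℚ) ^ (q * p) • K.bracket b p s (K.bracket q r b y z) x
      + (-1 : ℚ) ^ (r * q) • K.bracket c q s (K.bracket r p c z x) y = 0 := by
  subst ha hb hc hs
  exact K.jacobi p q r x y z

/-- A derivation of degree zero that commutes with the differential. -/
structure Derivation (K : DGL.{u}) where
  D : ∀ n, K.X.X n →ₗ[ℚ] K.X.X n
  D_d : ∀ i j x, D j ((K.X.d i j).hom x) = (K.X.d i j).hom (D i x)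
  D_bracket : ∀ p q r x y, D r (K.bracket p q r x y) =
    K.bracket p q r (D p x) y + K.bracket p q r x (D q y)

namespace Derivation

variable {K : DGL.{u}} (δ : Derivation K)

/-- Elements `a + b dt` of degree `n` in the path object; in degree zero only cycles are allowed. -/
def pathDeg (n : ℕ) : Submodule ℚ (K.X.X n × K.X.X (n + 1)) where
  carrier := {x | n = 0 → (K.X.d (n + 1) n).hom x.2 + δ.D n x.1 = 0}
  add_mem' {x y} hx hy h := by
    rw [Prod.fst_add, Prod.snd_add, map_add, map_add, add_add_add_comm, hx h, hy h, add_zero]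
  zero_mem' _ := by simp
  smul_mem' c x hx h := by
    rw [Prod.smul_fst, Prod.smul_snd, map_smul, map_smul, ← smul_add, hx h, smul_zero]

/-- The differential `a + b dt ↦ ∂ a + (∂ b + (-1)^n a') dt`. -/
def pathD (n : ℕ) : δ.pathDeg (n + 1) →ₗ[ℚ] δ.pathDeg n :=
  LinearMap.restrict
    (LinearMap.prod ((K.X.d (n + 1) n).hom ∘ₗ LinearMap.fst ℚ _ _)
      ((K.X.d (n + 2) (n + 1)).hom ∘ₗ LinearMap.snd ℚ _ _ +
        (-1 : ℚ) ^ (n + 1) • (δ.D (n + 1) ∘ₗ LinearMap.fst ℚ _ _)))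
    (by
      rintro ⟨a, b⟩ - rfl
      simp [RatComplex.d_d, δ.D_d])

lemma pathD_fst (n : ℕ) (x : δ.pathDeg (n + 1)) :
    (δ.pathD n x).1.1 = (K.X.d (n + 1) n).hom x.1.1 := rfl

lemma pathD_snd (n : ℕ) (x : δ.pathDeg (n + 1)) : (δ.pathD n x).1.2 =
    (K.X.d (n + 2) (n + 1)).hom x.1.2 + (-1 : ℚ) ^ (n + 1) • δ.D (n + 1) x.1.1 := rfl

/-- The underlying complex of the path object. -/
def pathComplex : RatComplex.{u} :=
  ChainComplex.of (fun n => ModuleCat.of ℚ (δ.pathDeg n)) (fun n => ModuleCat.ofHom (δ.pathD n))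
    (fun n => by
      refine ModuleCat.hom_ext (LinearMap.ext fun x => Subtype.ext (Prod.ext ?_ ?_))
      · exact RatComplex.d_d K.X _ _ _ _
      change (δ.pathD n (δ.pathD (n + 1) x)).1.2 = 0
      rw [pathD_snd, pathD_snd, pathD_fst, map_add, RatComplex.d_d, map_smul, δ.D_d, zero_add,
        ← add_smul, pow_succ, mul_neg_one, neg_add_cancel, zero_smul])

lemma pathComplex_d (n : ℕ) (x : δ.pathDeg (n + 1)) :
    (δ.pathComplex.d (n + 1) n).hom x = δ.pathD n x :=
  congrArg (fun g => g.hom x) (ChainComplex.of_d (fun n => ModuleCat.of ℚ (δ.pathDeg n))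
    (fun n => ModuleCat.ofHom (δ.pathD n)) n)

/-- The bracket on `K ⊕ K dt`. -/
def pathBracketAux (p q r : ℕ) : K.X.X p × K.X.X (p + 1) →ₗ[ℚ] K.X.X q × K.X.X (q + 1) →ₗ[ℚ]
    K.X.X r × K.X.X (r + 1) :=
  LinearMap.mk₂ ℚ (fun x y => (K.bracket p q r x.1 y.1,
    K.bracket p (q + 1) (r + 1) x.1 y.2 + (-1 : ℚ) ^ q • K.bracket (p + 1) q (r + 1) x.2 y.1))
    (fun _ _ _ => Prod.ext (by simp) (by simp; abel))
    (fun _ _ _ => Prod.ext (by simp) (by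
      simp only [Prod.smul_fst, Prod.smul_snd, map_smul, LinearMap.smul_apply, smul_add]
      rw [smul_comm ((-1 : ℚ) ^ q)]))
    (fun _ _ _ => Prod.ext (by simp) (by simp; abel))
    (fun _ _ _ => Prod.ext (by simp) (by
      simp only [Prod.smul_fst, Prod.smul_snd, map_smul, smul_add]
      rw [smul_comm ((-1 : ℚ) ^ q)]))

lemma pathBracketAux_apply (p q r : ℕ) (x : K.X.X p × K.X.X (p + 1))
    (y : K.X.X q × K.X.X (q + 1)) : pathBracketAux p q r x y = (K.bracket p q r x.1 y.1,
    K.bracket p (q + 1) (r + 1) x.1 y.2 +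
      (-1 : ℚ) ^ q • K.bracket (p + 1) q (r + 1) x.2 y.1) := rfl

lemma pathBracketAux_shape (p q r : ℕ) (h : p + q ≠ r) :
    pathBracketAux (K := K) p q r = 0 := by
  refine LinearMap.ext fun x => LinearMap.ext fun y => ?_
  rw [pathBracketAux_apply, K.bracket_shape p q r h, K.bracket_shape p (q + 1) (r + 1) (by omega),
    K.bracket_shape (p + 1) q (r + 1) (by omega)]
  refine Prod.ext rfl ?_
  change (0 : K.X.X (r + 1)) + (-1 : ℚ) ^ q • (0 : K.X.X (r + 1)) = 0
  rw [smul_zero, add_zero]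

lemma pathBracketAux_mem (p q r : ℕ) (x : δ.pathDeg p) (y : δ.pathDeg q) :
    pathBracketAux p q r x.1 y.1 ∈ δ.pathDeg r := by
  by_cases h : p + q = r
  · intro hr
    obtain ⟨rfl, rfl⟩ := Nat.add_eq_zero_iff.1 (h.trans hr)
    subst hr
    change (K.X.d 1 0).hom (K.bracket 0 1 1 x.1.1 y.1.2 + (-1 : ℚ) ^ 0 •
      K.bracket 1 0 1 x.1.2 y.1.1) + δ.D 0 (K.bracket 0 0 0 x.1.1 y.1.1) = 0
    rw [map_add, map_smul, K.d_bracket_zero_left 0, K.d_bracket_zero_right 0, δ.D_bracket,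
      eq_neg_of_add_eq_zero_left (x.2 rfl), eq_neg_of_add_eq_zero_left (y.2 rfl), map_neg,
      map_neg, LinearMap.neg_apply]
    module
  · rw [pathBracketAux_shape p q r h]
    exact Submodule.zero_mem _

/-- The bracket of the path object. -/
def pathBracket (p q r : ℕ) : δ.pathDeg p →ₗ[ℚ] δ.pathDeg q →ₗ[ℚ] δ.pathDeg r :=
  LinearMap.mk₂ ℚ (fun x y => ⟨pathBracketAux p q r x.1 y.1, δ.pathBracketAux_mem p q r x y⟩)
    (fun _ _ _ => Subtype.ext (by simp)) (fun _ _ _ => Subtype.ext (by simp))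
    (fun _ _ _ => Subtype.ext (by simp)) (fun _ _ _ => Subtype.ext (by simp))

lemma pathBracket_fst (p q r : ℕ) (x : δ.pathDeg p) (y : δ.pathDeg q) :
    (δ.pathBracket p q r x y).1.1 = K.bracket p q r x.1.1 y.1.1 := rfl

lemma pathBracket_snd (p q r : ℕ) (x : δ.pathDeg p) (y : δ.pathDeg q) :
    (δ.pathBracket p q r x y).1.2 = K.bracket p (q + 1) (r + 1) x.1.1 y.1.2 +
      (-1 : ℚ) ^ q • K.bracket (p + 1) q (r + 1) x.1.2 y.1.1 := rfl

lemma pathBracket_shape (p q r : ℕ) (h : p + q ≠ r) : δ.pathBracket p q r = 0 := by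
  refine LinearMap.ext fun x => LinearMap.ext fun y => Subtype.ext ?_
  exact congrArg (fun f => f x.1 y.1) (pathBracketAux_shape p q r h)

lemma pathBracket_symm (p q r : ℕ) (x : δ.pathDeg p) (y : δ.pathDeg q) :
    δ.pathBracket p q r x y = (-1 : ℚ) ^ (p * q + 1) • δ.pathBracket q p r y x := by
  refine Subtype.ext (Prod.ext (K.bracket_symm p q r _ _) ?_)
  change (δ.pathBracket p q r x y).1.2 =
    (-1 : ℚ) ^ (p * q + 1) • (δ.pathBracket q p r y x).1.2
  rw [pathBracket_snd, pathBracket_snd, K.bracket_symm p (q + 1), K.bracket_symm (p + 1) q,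
    smul_add, smul_smul, smul_smul]
  refine (add_comm _ _).trans (congrArg₂ (· + ·) (congrArg (· • _) ?_) (congrArg (· • _) ?_))
  · rw [← pow_add, show q + ((p + 1) * q + 1) = (p * q + 1) + 2 * q by ring, pow_add, pow_mul]
    simp
  · rw [← pow_add]
    ring

lemma pathBracket_jacobi (p q r : ℕ) (x : δ.pathDeg p) (y : δ.pathDeg q) (z : δ.pathDeg r) :
    (-1 : ℚ) ^ (p * r) • δ.pathBracket (p + q) r (p + q + r) (δ.pathBracket p q (p + q) x y) z
      + (-1 : ℚ) ^ (q * p) • δ.pathBracket (q + r) p (p + q + r) (δ.pathBracket q r (q + r) y z) x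
      + (-1 : ℚ) ^ (r * q) • δ.pathBracket (r + p) q (p + q + r) (δ.pathBracket r p (r + p) z x) y
      = 0 := by
  refine Subtype.ext (Prod.ext (K.jacobi p q r _ _ _) ?_)
  change (-1 : ℚ) ^ (p * r) •
      (δ.pathBracket (p + q) r (p + q + r) (δ.pathBracket p q (p + q) x y) z).1.2
      + (-1 : ℚ) ^ (q * p) •
      (δ.pathBracket (q + r) p (p + q + r) (δ.pathBracket q r (q + r) y z) x).1.2
      + (-1 : ℚ) ^ (r * q) •
      (δ.pathBracket (r + p) q (p + q + r) (δ.pathBracket r p (r + p) z x) y).1.2 = 0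
  simp only [pathBracket_snd, pathBracket_fst, map_add, LinearMap.add_apply, map_smul,
    LinearMap.smul_apply]
  have jacobi_z := K.jacobi_of_eq (p := p) (q := q) (r := r + 1) (a := p + q) (b := q + r + 1)
    (c := r + p + 1) (s := p + q + r + 1) rfl rfl (by omega) rfl x.1.1 y.1.1 z.1.2
  have jacobi_y := K.jacobi_of_eq (p := p) (q := q + 1) (r := r) (a := p + q + 1) (b := q + r + 1)
    (c := r + p) (s := p + q + r + 1) rfl (by omega) rfl (by omega) x.1.1 y.1.2 z.1.1
  have jacobi_x := K.jacobi_of_eq (p := p + 1) (q := q) (r := r) (a := p + q + 1) (b := q + r)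
    (c := r + p + 1) (s := p + q + r + 1) (by omega) rfl rfl (by omega) x.1.2 y.1.1 z.1.1
  rw [show p * (r + 1) = p * r + p by ring, show (r + 1) * q = r * q + q by ring,
    pow_add, pow_add] at jacobi_z
  rw [show (q + 1) * p = q * p + p by ring, show r * (q + 1) = r * q + r by ring,
    pow_add, pow_add] at jacobi_y
  rw [show (p + 1) * r = p * r + r by ring, show q * (p + 1) = q * p + q by ring,
    pow_add, pow_add] at jacobi_x
  generalize (-1 : ℚ) ^ (p * r) = a at *
  generalize (-1 : ℚ) ^ (q * p) = b at *
  generalize (-1 : ℚ) ^ (r * q) = c at *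
  have hp := neg_one_pow_eq_or ℚ p
  have hq := neg_one_pow_eq_or ℚ q
  have hr := neg_one_pow_eq_or ℚ r
  generalize (-1 : ℚ) ^ p = sp at *
  generalize (-1 : ℚ) ^ q = sq at *
  generalize (-1 : ℚ) ^ r = sr at *
  linear_combination (norm := (rcases hp with rfl | rfl <;> rcases hq with rfl | rfl <;>
    rcases hr with rfl | rfl <;> module)) sp • jacobi_z + sr • jacobi_y + sq • jacobi_x

lemma pathD_pathBracket_succ_succ (p q r : ℕ) (hr : p + 1 + q = r) (x : δ.pathDeg (p + 1))
    (y : δ.pathDeg (q + 1)) : δ.pathD r (δ.pathBracket (p + 1) (q + 1) (r + 1) x y) =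
      δ.pathBracket p (q + 1) r (δ.pathD p x) y +
        (-1 : ℚ) ^ (p + 1) • δ.pathBracket (p + 1) q r x (δ.pathD q y) := by
  refine Subtype.ext (Prod.ext (K.d_bracket (p + 1) (q + 1) (r + 1) (by omega) _ _) ?_)
  change (δ.pathD r (δ.pathBracket (p + 1) (q + 1) (r + 1) x y)).1.2 =
      (δ.pathBracket p (q + 1) r (δ.pathD p x) y).1.2 +
        (-1 : ℚ) ^ (p + 1) • (δ.pathBracket (p + 1) q r x (δ.pathD q y)).1.2
  simp only [pathD_snd, pathD_fst, pathBracket_snd, pathBracket_fst]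
  have d_bracket_y := K.d_bracket (p + 1) (q + 2) (r + 2) (by omega) x.1.1 y.1.2
  have d_bracket_x := K.d_bracket (p + 2) (q + 1) (r + 2) (by omega) x.1.2 y.1.1
  change (K.X.d (r + 2) (r + 1)).hom _ = K.bracket p (q + 2) (r + 1)
    ((K.X.d (p + 1) p).hom x.1.1) y.1.2 + (-1 : ℚ) ^ (p + 1) •
    K.bracket (p + 1) (q + 1) (r + 1) x.1.1 ((K.X.d (q + 2) (q + 1)).hom y.1.2) at d_bracket_y
  change (K.X.d (r + 2) (r + 1)).hom _ = K.bracket (p + 1) (q + 1) (r + 1)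
    ((K.X.d (p + 2) (p + 1)).hom x.1.2) y.1.1 + (-1 : ℚ) ^ (p + 2) •
    K.bracket (p + 2) q (r + 1) x.1.2 ((K.X.d (q + 1) q).hom y.1.1) at d_bracket_x
  rw [map_add, map_smul, d_bracket_y, d_bracket_x, δ.D_bracket, ← hr]
  simp only [map_add, LinearMap.add_apply, map_smul, LinearMap.smul_apply, pow_add, pow_one]
  have hp := neg_one_pow_eq_or ℚ p
  have hq := neg_one_pow_eq_or ℚ q
  generalize (-1 : ℚ) ^ p = sp at *
  generalize (-1 : ℚ) ^ q = sq at *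
  rcases hp with rfl | rfl <;> rcases hq with rfl | rfl <;> module

lemma pathD_pathBracket_zero_succ (q r : ℕ) (hr : q = r) (x : δ.pathDeg 0)
    (y : δ.pathDeg (q + 1)) : δ.pathD r (δ.pathBracket 0 (q + 1) (r + 1) x y) =
      δ.pathBracket 0 q r x (δ.pathD q y) := by
  subst hr
  have d_bracket_y := K.d_bracket_zero_left (q + 1) x.1.1 y.1.2
  have d_bracket_x := K.d_bracket 1 (q + 1) (q + 2) (by omega) x.1.2 y.1.1
  refine Subtype.ext (Prod.ext (K.d_bracket_zero_left q x.1.1 y.1.1) ?_)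
  simp only [pathD_snd, pathD_fst, pathBracket_snd, pathBracket_fst]
  change (K.X.d (q + 2) (q + 1)).hom _ = K.bracket 0 (q + 1) (q + 1)
    ((K.X.d 1 0).hom x.1.2) y.1.1 + (-1 : ℚ) ^ 1 •
    K.bracket 1 q (q + 1) x.1.2 ((K.X.d (q + 1) q).hom y.1.1) at d_bracket_x
  rw [map_add, map_smul, d_bracket_y, d_bracket_x, δ.D_bracket,
    eq_neg_of_add_eq_zero_left (x.2 rfl)]
  simp only [map_add, map_neg, LinearMap.neg_apply, map_smul, pow_add, pow_one]
  module

lemma pathD_pathBracket_succ_zero (p r : ℕ) (hr : p = r) (x : δ.pathDeg (p + 1))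
    (y : δ.pathDeg 0) : δ.pathD r (δ.pathBracket (p + 1) 0 (r + 1) x y) =
      δ.pathBracket p 0 r (δ.pathD p x) y := by
  subst hr
  have d_bracket_y := K.d_bracket (p + 1) 1 (p + 2) (by omega) x.1.1 y.1.2
  have d_bracket_x := K.d_bracket_zero_right (p + 1) x.1.2 y.1.1
  refine Subtype.ext (Prod.ext (K.d_bracket_zero_right p x.1.1 y.1.1) ?_)
  simp only [pathD_snd, pathD_fst, pathBracket_snd, pathBracket_fst]
  change (K.X.d (p + 2) (p + 1)).hom _ = K.bracket p 1 (p + 1)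
    ((K.X.d (p + 1) p).hom x.1.1) y.1.2 + (-1 : ℚ) ^ (p + 1) •
    K.bracket (p + 1) 0 (p + 1) x.1.1 ((K.X.d 1 0).hom y.1.2) at d_bracket_y
  rw [map_add, map_smul, d_bracket_y, d_bracket_x, δ.D_bracket,
    eq_neg_of_add_eq_zero_left (y.2 rfl)]
  simp only [map_add, map_neg, LinearMap.add_apply, map_smul, LinearMap.smul_apply, pow_add,
    pow_one, pow_zero]
  module

end Derivation

end DGL

namespace DGL

namespace Derivation

variable {K : DGL.{u}} (δ : Derivation K)

lemma d_pathBracket (p q r : ℕ) (hr : p + q = r) (x : δ.pathDeg p) (y : δ.pathDeg q) :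
    (δ.pathComplex.d r (r - 1)).hom (δ.pathBracket p q r x y) =
      δ.pathBracket (p - 1) q (r - 1) ((δ.pathComplex.d p (p - 1)).hom x) y +
        (-1 : ℚ) ^ p • δ.pathBracket p (q - 1) (r - 1) x
          ((δ.pathComplex.d q (q - 1)).hom y) := by
  have hzero := δ.pathComplex.d_apply_zero
  rcases p with _ | p <;> rcases q with _ | q
  · obtain rfl : r = 0 := hr.symm
    refine (hzero _).trans (Eq.symm ?_)
    refine (congrArg₂ (fun z w => δ.pathBracket 0 0 0 z y + (-1 : ℚ) ^ 0 •
      δ.pathBracket 0 0 0 x w) (hzero x) (hzero y)).trans ?_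
    exact (congrArg₂ (· + (-1 : ℚ) ^ 0 • ·) (LinearMap.map_zero₂ _ _) (map_zero _)).trans
      (by rw [smul_zero, add_zero]; rfl)
  · obtain ⟨r, rfl⟩ : ∃ r', r = r' + 1 := ⟨r - 1, by omega⟩
    refine (δ.pathComplex_d r _).trans ?_
    refine (δ.pathD_pathBracket_zero_succ q r (by omega) x y).trans (Eq.symm ?_)
    refine (congrArg₂ (fun z w => δ.pathBracket 0 (q + 1) r z y + (-1 : ℚ) ^ 0 •
      δ.pathBracket 0 q r x w) (hzero x) (δ.pathComplex_d q y)).trans ?_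
    exact (congrArg (· + _) (LinearMap.map_zero₂ _ _)).trans
      (by rw [zero_add, pow_zero, one_smul])
  · obtain ⟨r, rfl⟩ : ∃ r', r = r' + 1 := ⟨r - 1, by omega⟩
    refine (δ.pathComplex_d r _).trans ?_
    refine (δ.pathD_pathBracket_succ_zero p r (by omega) x y).trans (Eq.symm ?_)
    refine (congrArg₂ (fun z w => δ.pathBracket p 0 r z y + (-1 : ℚ) ^ (p + 1) •
      δ.pathBracket (p + 1) 0 r x w) (δ.pathComplex_d p x) (hzero y)).trans ?_
    exact (congrArg (fun z => _ + (-1 : ℚ) ^ (p + 1) • z) (map_zero _)).trans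
      (by rw [smul_zero, add_zero])
  · obtain ⟨r, rfl⟩ : ∃ r', r = r' + 1 := ⟨r - 1, by omega⟩
    refine (δ.pathComplex_d r _).trans ?_
    refine (δ.pathD_pathBracket_succ_succ p q r (by omega) x y).trans ?_
    exact congrArg₂ (fun z w => δ.pathBracket p (q + 1) r z y +
      (-1 : ℚ) ^ (p + 1) • δ.pathBracket (p + 1) q r x w)
      (δ.pathComplex_d p x).symm (δ.pathComplex_d q y).symm

/-- The path object of a DGL with a derivation `a ↦ a'`: elements `a + b dt`, where `dt` has
degree `-1` and `∂ (a + b dt) = ∂ a + (∂ b + (-1)^n a') dt` for `a` of degree `n`. -/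
def pathDGL : DGL.{u} where
  X := δ.pathComplex
  bracket p q r := δ.pathBracket p q r
  bracket_shape p q r h := δ.pathBracket_shape p q r h
  bracket_symm p q r x y := δ.pathBracket_symm p q r x y
  jacobi p q r x y z := δ.pathBracket_jacobi p q r x y z
  d_bracket p q r hr x y := δ.d_pathBracket p q r hr x y

/-- The projection `a + b dt ↦ a` of the path object. -/
def pathProj : δ.pathDGL ⟶ K where
  f :=
    { f := fun n => ModuleCat.ofHom (LinearMap.fst ℚ _ _ ∘ₗ (δ.pathDeg n).subtype)
      comm' := fun i j h => by
        obtain rfl : j + 1 = i := h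
        ext x
        exact (congrArg (fun z : δ.pathDeg j => z.1.1) (δ.pathComplex_d j x)).symm }
  map_bracket _ _ _ _ _ := rfl

lemma d_snd_add_of_mem_cyc (n : ℕ) (x : δ.pathDeg n) (hx : x ∈ δ.pathDGL.cyc n) :
    (K.X.d (n + 1) n).hom x.1.2 + (-1 : ℚ) ^ n • δ.D n x.1.1 = 0 := by
  rcases n with _ | n
  · rw [pow_zero, one_smul]
    exact x.2 rfl
  · have h : δ.pathD n x = 0 := (δ.pathComplex_d n x).symm.trans hx
    exact congrArg (fun z : δ.pathDeg n => z.1.2) h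

end Derivation

/-! ### Polynomial paths -/

open TensorProduct

section Polynomial

variable (K : DGL.{u})

/-- Differentiation of polynomials with coefficients in the degree `n` part of a DGL. -/
abbrev polyD (n : ℕ) : K.X.X n ⊗[ℚ] Polynomial ℚ →ₗ[ℚ] K.X.X n ⊗[ℚ] Polynomial ℚ :=
  LinearMap.lTensor (K.X.X n) Polynomial.derivative

lemma polyD_d (i j : ℕ) (x : K.X.X i ⊗[ℚ] Polynomial ℚ) :
    K.polyD j (LinearMap.rTensor (Polynomial ℚ) (K.X.d i j).hom x) =
      LinearMap.rTensor (Polynomial ℚ) (K.X.d i j).hom (K.polyD i x) := by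
  rw [← LinearMap.comp_apply, ← LinearMap.comp_apply, LinearMap.lTensor_comp_rTensor,
    LinearMap.rTensor_comp_lTensor]

lemma polyD_bracket (p q r : ℕ) (x : K.X.X p ⊗[ℚ] Polynomial ℚ)
    (y : K.X.X q ⊗[ℚ] Polynomial ℚ) :
    K.polyD r (K.tensorBracket (Polynomial ℚ) p q r x y) =
      K.tensorBracket (Polynomial ℚ) p q r (K.polyD p x) y +
      K.tensorBracket (Polynomial ℚ) p q r x (K.polyD q y) := by
  induction x using TensorProduct.induction_on with
  | zero => simp
  | add x x' hx hx' =>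
    simp only [map_add, LinearMap.add_apply, hx, hx']
    abel
  | tmul x f =>
    induction y using TensorProduct.induction_on with
    | zero => simp
    | add y y' hy hy' =>
      simp only [map_add, hy, hy']
      abel
    | tmul y g =>
      simp only [tensorBracket_tmul, LinearMap.lTensor_tmul, Polynomial.derivative_mul,
        TensorProduct.tmul_add]

/-- The derivation `d/dt` of `K[t]`. -/
def polyDerivation : Derivation (K.baseChange (Polynomial ℚ)) where
  D n := K.polyD n
  D_d i j x := K.polyD_d i j x
  D_bracket p q r x y := K.polyD_bracket p q r x y

/-- Integration of polynomials over the unit interval. -/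
def polyIntegral : Polynomial ℚ →ₗ[ℚ] ℚ :=
  Polynomial.lsum fun n => ((n : ℚ) + 1)⁻¹ • LinearMap.id

lemma polyIntegral_monomial (n : ℕ) (a : ℚ) :
    polyIntegral (Polynomial.monomial n a) = ((n : ℚ) + 1)⁻¹ * a := by
  simp [polyIntegral, Polynomial.sum_monomial_index]

lemma polyIntegral_derivative (f : Polynomial ℚ) : polyIntegral (Polynomial.derivative f) =
    Polynomial.aeval (1 : ℚ) f - Polynomial.aeval (0 : ℚ) f := by
  induction f using Polynomial.induction_on' with
  | add f g hf hg => rw [map_add, map_add, hf, hg, map_add, map_add]; ring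
  | monomial n a =>
    rw [Polynomial.derivative_monomial, polyIntegral_monomial]
    rcases n with _ | n
    · simp
    · have hn : (n : ℚ) + 1 ≠ 0 := by positivity
      simp [Polynomial.aeval_monomial, mul_comm a, hn]

lemma tensorEval_polyIntegral (n : ℕ) (x : K.X.X n ⊗[ℚ] Polynomial ℚ) :
    K.tensorEval polyIntegral n (K.polyD n x) =
      K.tensorEval (Polynomial.aeval (1 : ℚ)).toLinearMap n x -
        K.tensorEval (Polynomial.aeval (0 : ℚ)).toLinearMap n x := by
  induction x using TensorProduct.induction_on with
  | zero => simp
  | add x x' hx hx' =>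
    rw [map_add, map_add, map_add, map_add, hx, hx']
    abel
  | tmul x f =>
    change polyIntegral (Polynomial.derivative f) • x = Polynomial.aeval (1 : ℚ) f • x -
      Polynomial.aeval (0 : ℚ) f • x
    rw [polyIntegral_derivative, sub_smul]

lemma tensorEval_sub_mem_bdry (n : ℕ) (x : K.X.X n ⊗[ℚ] Polynomial ℚ)
    (y : K.X.X (n + 1) ⊗[ℚ] Polynomial ℚ)
    (h : LinearMap.rTensor (Polynomial ℚ) (K.X.d (n + 1) n).hom y +
      (-1 : ℚ) ^ n • K.polyD n x = 0) :
    K.tensorEval (Polynomial.aeval (1 : ℚ)).toLinearMap n x -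
      K.tensorEval (Polynomial.aeval (0 : ℚ)).toLinearMap n x ∈ K.bdry n := by
  replace h := (congrArg (K.tensorEval polyIntegral n) h).trans (map_zero _)
  rw [map_add, map_smul, tensorEval_d, tensorEval_polyIntegral] at h
  have hbdry := (Submodule.neg_mem_iff _).2 (LinearMap.mem_range_self (K.X.d (n + 1) n).hom
    (K.tensorEval polyIntegral (n + 1) y))
  rw [← eq_neg_of_add_eq_zero_right h] at hbdry
  exact (Submodule.smul_mem_iff _ (pow_ne_zero n (by norm_num : (-1 : ℚ) ≠ 0))).1 hbdry

/-- The path object `K[t, dt]`. -/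
abbrev polyPath : DGL.{u} := K.polyDerivation.pathDGL

/-- Evaluation of polynomial paths at a rational number. -/
def polyPathEval (c : ℚ) : K.polyPath ⟶ K :=
  K.polyDerivation.pathProj ≫ K.baseChangeEval (Polynomial.aeval c)

/-- The endpoints of a cycle `a + b dt` differ by the boundary of the integral of `b`. -/
theorem Hmap_polyPathEval_one (n : ℕ) :
    Hmap (Hom.f (K.polyPathEval 1)) n = Hmap (Hom.f (K.polyPathEval 0)) n :=
  Hmap_eq_iff.2 fun x => K.tensorEval_sub_mem_bdry n _ _
    (K.polyDerivation.d_snd_add_of_mem_cyc n x.1 x.2)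

end Polynomial

end DGL

namespace RatComplex.Splitting

open TensorProduct

variable {V : RatComplex.{u}} (S : Splitting V) {Y : DGL.{u}} (ι : V ⟶ Y.X)

/-- The polynomial part `proj + null t` of the canonical path from the projection to the
identity. -/
def pathFst (n : ℕ) : V.X n →ₗ[ℚ] Y.X.X n ⊗[ℚ] Polynomial ℚ :=
  (TensorProduct.mk ℚ (Y.X.X n) (Polynomial ℚ)).flip 1 ∘ₗ (ι.f n).hom ∘ₗ S.proj n +
    (TensorProduct.mk ℚ (Y.X.X n) (Polynomial ℚ)).flip Polynomial.X ∘ₗ (ι.f n).hom ∘ₗ S.null n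

lemma pathFst_apply (n : ℕ) (v : V.X n) : S.pathFst ι n v =
    (ι.f n).hom (S.proj n v) ⊗ₜ 1 + (ι.f n).hom (S.null n v) ⊗ₜ Polynomial.X := rfl

/-- The coefficient of `dt` in the canonical path from the projection to the identity. -/
def pathSnd (n : ℕ) : V.X n →ₗ[ℚ] Y.X.X (n + 1) ⊗[ℚ] Polynomial ℚ :=
  (-1 : ℚ) ^ (n + 1) • ((TensorProduct.mk ℚ (Y.X.X (n + 1)) (Polynomial ℚ)).flip 1 ∘ₗ
    (ι.f (n + 1)).hom ∘ₗ S.h n (n + 1))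

lemma pathSnd_apply (n : ℕ) (v : V.X n) : S.pathSnd ι n v =
    (-1 : ℚ) ^ (n + 1) • ((ι.f (n + 1)).hom (S.h n (n + 1) v) ⊗ₜ 1) := rfl

lemma d_pathSnd_add (n : ℕ) (v : V.X n) :
    LinearMap.rTensor (Polynomial ℚ) (Y.X.d (n + 1) n).hom (S.pathSnd ι n v) +
      (-1 : ℚ) ^ n • Y.polyD n (S.pathFst ι n v) =
    (-1 : ℚ) ^ n • ((ι.f n).hom (S.h (n - 1) n ((V.d n (n - 1)).hom v)) ⊗ₜ 1) := by
  rw [pathSnd_apply, pathFst_apply, map_smul, LinearMap.rTensor_tmul, map_add,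
    LinearMap.lTensor_tmul, LinearMap.lTensor_tmul, Polynomial.derivative_one,
    Polynomial.derivative_X, TensorProduct.tmul_zero, zero_add, ← map_d, S.null_apply, map_add,
    TensorProduct.add_tmul, pow_succ]
  module

lemma d_null (i j : ℕ) (v : V.X i) : (V.d i j).hom (S.null i v) = (V.d i j).hom v := by
  have h := S.d_proj i j v
  rwa [proj_apply, map_sub, sub_eq_zero, eq_comm] at h

lemma null_d (i j : ℕ) (v : V.X i) : S.null j ((V.d i j).hom v) = (V.d i j).hom v := by
  have h := S.proj_d j i v
  rwa [proj_apply, sub_eq_zero, eq_comm] at h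

lemma d_pathFst (i j : ℕ) (v : V.X i) :
    LinearMap.rTensor (Polynomial ℚ) (Y.X.d i j).hom (S.pathFst ι i v) =
      S.pathFst ι j ((V.d i j).hom v) := by
  rw [pathFst_apply, pathFst_apply, map_add, LinearMap.rTensor_tmul,
    LinearMap.rTensor_tmul, ← map_d, ← map_d, S.d_proj, S.proj_d, S.d_null, S.null_d, map_zero]

/-- The canonical path from the projection to the identity. -/
def path (n : ℕ) : V.X n →ₗ[ℚ] Y.polyDerivation.pathDeg n :=
  LinearMap.codRestrict _ (LinearMap.prod (S.pathFst ι n) (S.pathSnd ι n)) (by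
    rintro v rfl
    have h := S.d_pathSnd_add ι 0 v
    rw [d_apply_zero, map_zero, map_zero, TensorProduct.zero_tmul, smul_zero, pow_zero,
      one_smul] at h
    exact h)

/-- The canonical path from the projection to the identity, as a chain map. -/
def pathHom : V ⟶ Y.polyPath.X where
  f n := ModuleCat.ofHom (S.path ι n)
  comm' i j h := by
    obtain rfl : j + 1 = i := h
    refine ModuleCat.hom_ext (LinearMap.ext fun v => ?_)
    refine (Y.polyDerivation.pathComplex_d j (S.path ι (j + 1) v)).trans ?_
    refine Subtype.ext (Prod.ext (S.d_pathFst ι (j + 1) j v) ?_)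
    exact (S.d_pathSnd_add ι (j + 1) v).trans (S.pathSnd_apply ι j _).symm

lemma polyPathEval_zero_pathHom (n : ℕ) (v : V.X n) :
    ((DGL.Hom.f (Y.polyPathEval 0)).f n).hom (((S.pathHom ι).f n).hom v) =
      (ι.f n).hom (S.proj n v) := by
  change Y.tensorEval _ n (S.pathFst ι n v) = _
  rw [pathFst_apply, map_add, DGL.tensorEval_tmul, DGL.tensorEval_tmul]
  simp

lemma polyPathEval_one_pathHom (n : ℕ) (v : V.X n) :
    ((DGL.Hom.f (Y.polyPathEval 1)).f n).hom (((S.pathHom ι).f n).hom v) = (ι.f n).hom v := by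
  change Y.tensorEval _ n (S.pathFst ι n v) = _
  rw [pathFst_apply, map_add, DGL.tensorEval_tmul, DGL.tensorEval_tmul]
  simp [proj_apply]

end RatComplex.Splitting

/-! ### Homology of free DGLs -/

namespace DGL

lemma Hmap_comp {K L M : DGL.{u}} (φ : K.X ⟶ L.X) (ψ : L.X ⟶ M.X) (n : ℕ) :
    Hmap (K := K) (L := M) (φ ≫ ψ) n = Hmap ψ n ∘ₗ Hmap φ n :=
  Hmod_ext fun _ => rfl

lemma Hmap_id (K : DGL.{u}) (n : ℕ) : Hmap (𝟙 K.X) n = LinearMap.id :=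
  Hmod_ext fun _ => rfl

/-- The chain map out of `L / [L, L]` induced by a map to an abelian DGL. -/
def abDesc {K : DGL.{u}} {W : RatComplex.{u}} (F : K ⟶ triv W) : ab.obj K ⟶ W where
  f n := ModuleCat.ofHom ((K.decomposables n).liftQ ((Hom.f F).f n).hom (by
    refine Submodule.span_le.2 ?_
    rintro _ ⟨p, q, x, y, rfl⟩
    exact Hom.map_bracket F p q n x y))
  comm' i j _ := by
    ext : 1
    apply Submodule.linearMap_qext
    ext x
    exact (RatComplex.map_d (Hom.f F) i j x).symm

lemma ab_hom_ext {K : DGL.{u}} {W : RatComplex.{u}} {φ ψ : ab.obj K ⟶ W}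
    (h : Hom.f K.abProj ≫ φ = Hom.f K.abProj ≫ ψ) : φ = ψ := by
  ext n : 2
  apply Submodule.linearMap_qext
  ext x
  exact congrArg (fun g : K.X ⟶ W => (g.f n).hom x) h

namespace IsFreeOn

variable {V : RatComplex.{u}} {Y : DGL.{u}} {ι : V ⟶ Y.X}

/-- The canonical path from the projection to the identity of the generators extends to a path
in `Y[t, dt]` from `E` to the identity. -/
theorem Hmap_eq_id_of_proj (hι : IsFreeOn (L := Y) ι) (S : RatComplex.Splitting V) (E : Y ⟶ Y)
    (hE : ∀ n v, ((Hom.f E).f n).hom ((ι.f n).hom v) = (ι.f n).hom (S.proj n v)) (n : ℕ) :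
    Hmap (Hom.f E) n = LinearMap.id := by
  obtain ⟨F, hF⟩ := hι.exists_extension (S.pathHom ι)
  have hzero : F ≫ Y.polyPathEval 0 = E := hι.hom_ext fun n v => by
    rw [comp_apply, hF, S.polyPathEval_zero_pathHom, hE]
  have hone : F ≫ Y.polyPathEval 1 = 𝟙 Y := hι.hom_ext fun n v => by
    rw [comp_apply, hF, S.polyPathEval_one_pathHom]
    rfl
  calc Hmap (Hom.f E) n
      = Hmap (Hom.f (Y.polyPathEval 0)) n ∘ₗ Hmap (Hom.f F) n := by
        rw [← hzero]; exact Hmap_comp _ _ n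
    _ = Hmap (Hom.f (Y.polyPathEval 1)) n ∘ₗ Hmap (Hom.f F) n := by
        rw [Hmap_polyPathEval_one]
    _ = Hmap (Hom.f (𝟙 Y)) n := by rw [← hone]; exact (Hmap_comp _ _ n).symm
    _ = LinearMap.id := Hmap_id Y n

theorem homologyDGL_hom_ext (hι : IsFreeOn (L := Y) ι) {G : DGL.{u}}
    {φ ψ : Y.homologyDGL ⟶ G}
    (h : ∀ n (c : (triv V).Hmod n), ((Hom.f φ).f n).hom (Hmap (K := triv V) (L := Y) ι n c) =
      ((Hom.f ψ).f n).hom (Hmap (K := triv V) (L := Y) ι n c)) : φ = ψ := by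
  obtain ⟨S⟩ := (inferInstance : Nonempty (RatComplex.Splitting V))
  obtain ⟨E, hE⟩ := hι.exists_extension (S.chainMap (cycMap (K := triv V) (L := Y) ι))
  have hgen : E ≫ Y.cyclesProj ≫ φ = E ≫ Y.cyclesProj ≫ ψ := hι.hom_ext fun n v => by
    rw [comp_apply, comp_apply, comp_apply, comp_apply, hE]
    exact h n ((triv V).cls n (S.projCyc n v))
  have hid := hι.Hmap_eq_id_of_proj S (E ≫ Y.cyclesIncl) fun n v =>
    congrArg Subtype.val (hE n v)
  refine DGL.hom_ext fun n x => ?_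
  obtain ⟨x, rfl⟩ := Y.cls_surjective n x
  have hx : Y.cls n (((Hom.f E).f n).hom x.1) = Y.cls n x :=
    LinearMap.congr_fun (hid n) (Y.cls n x)
  rw [← hx]
  exact congrArg (fun F : Y ⟶ G => ((Hom.f F).f n).hom x.1) hgen

lemma Hmap_abProj_surjective (hι : IsFreeOn (L := Y) ι) (n : ℕ) :
    Function.Surjective
      (Hmap (K := triv V) (L := triv (ab.obj Y)) (ι ≫ Hom.f Y.abProj) n) := by
  obtain ⟨r, hr⟩ := hι.exists_extension (K := triv V) (𝟙 V)
  have hid : abDesc r ≫ ι ≫ Hom.f Y.abProj = 𝟙 (ab.obj Y) := by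
    let s : triv V ⟶ triv (ab.obj Y) := { f := ι ≫ Hom.f Y.abProj, map_bracket := by simp }
    have hs : r ≫ s = Y.abProj := hι.hom_ext fun n v => congrArg ((Hom.f s).f n).hom (hr n v)
    exact ab_hom_ext (congrArg Hom.f hs)
  refine Function.RightInverse.surjective (g := Hmap (K := triv (ab.obj Y)) (L := triv V)
    (abDesc r) n) fun x => ?_
  have h := Hmap_comp (K := triv (ab.obj Y)) (L := triv V) (M := triv (ab.obj Y)) (abDesc r)
    (ι ≫ Hom.f Y.abProj) n
  rw [hid] at h
  exact (LinearMap.congr_fun h x).symm.trans (LinearMap.congr_fun (Hmap_id (triv (ab.obj Y)) n) x)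

theorem Hmap_ab_eq (hι : IsFreeOn (L := Y) ι) {K : DGL.{u}} {F G : Y ⟶ K}
    (h : homologyDGLFunctor.map F = homologyDGLFunctor.map G) (n : ℕ) :
    Hmap (K := triv (ab.obj Y)) (L := triv (ab.obj K)) (ab.map F) n =
      Hmap (K := triv (ab.obj Y)) (L := triv (ab.obj K)) (ab.map G) n := by
  refine LinearMap.ext fun x => ?_
  obtain ⟨x, rfl⟩ := hι.Hmap_abProj_surjective n x
  obtain ⟨v, rfl⟩ := (triv V).cls_surjective n x
  exact congrArg (fun f => Hmap (L := triv (ab.obj K)) (Hom.f K.abProj) n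
    (f (Hmap (K := triv V) (L := Y) ι n ((triv V).cls n v))))
    ((homologyDGLFunctor_map_eq_iff F G).1 h n)

end IsFreeOn

end DGL

/-! ### Chain homotopies over a field -/

namespace RatComplex

lemma exists_homotopy_zero {V W : RatComplex.{u}} (φ : V ⟶ W)
    (h : ∀ n (c : (DGL.triv V).cyc n), (φ.f n).hom c.1 ∈ (DGL.triv W).bdry n) :
    Nonempty (Homotopy φ 0) := by
  obtain ⟨S⟩ := (inferInstance : Nonempty (Splitting V))
  obtain ⟨T⟩ := (inferInstance : Nonempty (Splitting W))
  have hproj : ∀ n (x : V.X n), (W.d (n + 1) n).hom (T.h n (n + 1) ((φ.f n).hom (S.proj n x))) =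
      (φ.f n).hom (S.proj n x) := fun n x => by
    obtain ⟨z, hz⟩ := h n (S.projCyc n x)
    have hz' : (W.d (n + 1) n).hom z = (φ.f n).hom (S.proj n x) := hz
    rw [← hz', T.d_h_d]
  let s : ∀ i j : ℕ, (ComplexShape.down ℕ).Rel j i → (V.X i ⟶ W.X j) := fun i j _ =>
    ModuleCat.ofHom (T.h i j ∘ₗ (φ.f i).hom ∘ₗ S.proj i + (φ.f j).hom ∘ₗ S.h i j)
  have hs : ∀ n (x : V.X n), (φ.f n).hom x =
      (W.d (n + 1) n).hom ((s n (n + 1) rfl).hom x) +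
        (φ.f n).hom (S.h (n - 1) n ((V.d n (n - 1)).hom x)) := fun n x => by
    change _ = (W.d (n + 1) n).hom (T.h n (n + 1) ((φ.f n).hom (S.proj n x)) +
      (φ.f (n + 1)).hom (S.h n (n + 1) x)) + _
    rw [map_add, hproj, ← map_d, add_assoc, ← map_add, ← S.null_apply, ← map_add, S.proj_apply,
      sub_add_cancel]
  suffices φ = Homotopy.nullHomotopicMap' s by
    rw [this]
    exact ⟨Homotopy.nullHomotopy' s⟩
  ext n x
  rcases n with _ | n
  · rw [Homotopy.nullHomotopicMap'_f_of_not_rel_left (show (ComplexShape.down ℕ).Rel 1 0 from rfl)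
      (by simp)]
    refine (hs 0 x).trans ?_
    rw [d_apply_zero, map_zero, map_zero, add_zero]
    rfl
  · rw [Homotopy.nullHomotopicMap'_f (k₂ := n + 2) (k₁ := n + 1) (k₀ := n) rfl rfl]
    refine (hs (n + 1) x).trans ((add_comm _ _).trans (congrArg (· + _) (Eq.symm ?_)))
    change T.h n (n + 1) ((φ.f n).hom (S.proj n ((V.d (n + 1) n).hom x))) + _ = _
    rw [S.proj_d, map_zero, map_zero, zero_add]
    rfl

theorem nonempty_homotopy_of_Hmap_eq {V W : RatComplex.{u}} {φ ψ : V ⟶ W}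
    (h : ∀ n, DGL.Hmap (K := DGL.triv V) (L := DGL.triv W) φ n =
      DGL.Hmap (K := DGL.triv V) (L := DGL.triv W) ψ n) : Nonempty (Homotopy φ ψ) :=
  (exists_homotopy_zero (φ - ψ) fun n => DGL.Hmap_eq_iff.1 (h n)).map
    (Homotopy.equivSubZero (f := φ) (g := ψ)).symm

end RatComplex

lemma homotopy_apply {V W : RatComplex.{u}} {φ ψ : V ⟶ W} (H : Homotopy φ ψ) (i : ℕ)
    (x : V.X i) : (φ.f i).hom x = (W.d (i + 1) i).hom ((H.hom i (i + 1)).hom x) +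
      (H.hom (i - 1) i).hom ((V.d i (i - 1)).hom x) + (ψ.f i).hom x := by
  rw [H.comm i, Homotopy.prevD_chainComplex]
  rcases i with _ | i
  · rw [Homotopy.dNext_zero_chainComplex, RatComplex.d_apply_zero, map_zero, zero_add, add_zero]
    rfl
  · rw [Homotopy.dNext_succ_chainComplex, add_comm (V.d (i + 1) i ≫ _)]
    rfl

lemma homPre_sub_mem_homBdry {V W : RatComplex.{u}} {φ ψ : V ⟶ W} (H : Homotopy φ ψ)
    {M : RatComplex.{u}} {t : ℤ} {f : HomFamily W M} (hf : f ∈ homCyc W M t) :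
    homPre φ M f - homPre ψ M f ∈ homBdry V M t := by
  have hd (i j : ℕ) (y : W.X i) : (M.d (j + 1) j).hom (f i (j + 1) y) =
      ((t.negOnePow : ℤˣ) : ℤ) • f (i - 1) j ((W.d i (i - 1)).hom y) :=
    LinearMap.congr_fun (sub_eq_zero.1 (congrFun (congrFun (LinearMap.mem_ker.1 hf.2) i) j)) y
  have hsq : ((t.negOnePow : ℤˣ) : ℤ) * ((t.negOnePow : ℤˣ) : ℤ) = 1 := by
    rw [← Units.val_mul, Int.units_mul_self, Units.val_one]
  refine ⟨fun i j => ((t.negOnePow : ℤˣ) : ℤ) • (f (i + 1) j ∘ₗ (H.hom i (i + 1)).hom),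
    fun i j hij => ?_, ?_⟩
  · change ((t.negOnePow : ℤˣ) : ℤ) • (f (i + 1) j ∘ₗ (H.hom i (i + 1)).hom) = 0
    rw [hf.1 (i + 1) j (by push_cast; omega), LinearMap.zero_comp, smul_zero]
  · funext i j
    refine LinearMap.ext fun x => ?_
    change (M.d (j + 1) j).hom (((t.negOnePow : ℤˣ) : ℤ) •
        f (i + 1) (j + 1) ((H.hom i (i + 1)).hom x)) -
      (((t + 1).negOnePow : ℤˣ) : ℤ) • (((t.negOnePow : ℤˣ) : ℤ) • f (i - 1 + 1) j
        ((H.hom (i - 1) (i - 1 + 1)).hom ((V.d i (i - 1)).hom x))) =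
      f i j ((φ.f i).hom x) - f i j ((ψ.f i).hom x)
    rw [homotopy_apply H i x, map_add, map_add, add_sub_cancel_right, map_zsmul, hd,
      Int.negOnePow_succ, Units.val_neg, smul_smul, smul_smul, neg_mul, hsq, one_smul, neg_smul,
      one_smul, sub_neg_eq_add]
    rcases i with _ | i
    · rw [RatComplex.d_apply_zero, map_zero, map_zero, map_zero, map_zero]
    · rfl

theorem hoHom_map_eq_of_homotopy {V W : RatComplex.{u}} {φ ψ : V ⟶ W} (H : Homotopy φ ψ)
    (M : RatComplex.{u}) (t : ℤ) : (hoHom M t).map φ.op = (hoHom M t).map ψ.op := by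
  ext : 1
  apply Submodule.linearMap_qext
  exact LinearMap.ext fun f => (Submodule.Quotient.eq _).2 (homPre_sub_mem_homBdry H f.2)

/-! ### Weak equivalences -/

namespace DGL

lemma nonempty_iso_of_bijective {K L : DGL.{u}} (F : K ⟶ L)
    (h : ∀ n, Function.Bijective ((Hom.f F).f n).hom) : Nonempty (K ≅ L) := by
  have (n : ℕ) : IsIso ((Hom.f F).f n) := (ConcreteCategory.isIso_iff_bijective _).2 (h n)
  have : IsIso (Hom.f F) := HomologicalComplex.Hom.isIso_of_components _
  have hom_inv (n) (x : K.X.X n) : ((inv (Hom.f F)).f n).hom (((Hom.f F).f n).hom x) = x :=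
    congrArg (fun g : K.X ⟶ K.X => (g.f n).hom x) (IsIso.hom_inv_id (Hom.f F))
  have inv_hom (n) (x : L.X.X n) : ((Hom.f F).f n).hom (((inv (Hom.f F)).f n).hom x) = x :=
    congrArg (fun g : L.X ⟶ L.X => (g.f n).hom x) (IsIso.inv_hom_id (Hom.f F))
  refine ⟨⟨F, ⟨inv (Hom.f F), fun p q r x y => ?_⟩, hom_ext hom_inv, hom_ext inv_hom⟩⟩
  apply (h r).1
  rw [inv_hom, Hom.map_bracket, inv_hom, inv_hom]

lemma nonempty_homologyDGL_iso_of_quasiIso {K L : DGL.{u}} (F : K ⟶ L)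
    (hF : QuasiIso (toComplex.map F)) : Nonempty (K.homologyDGL ≅ L.homologyDGL) :=
  nonempty_iso_of_bijective (homologyDGLFunctor.map F) fun n =>
    (isIso_homologyMap_iff (Hom.f F) n).1
      ((quasiIsoAt_iff_isIso_homologyMap _ n).1 (hF.quasiIsoAt n))

theorem WeaklyEquivalent.nonempty_homologyDGL_iso {K L : DGL.{u}} (h : WeaklyEquivalent K L) :
    Nonempty (K.homologyDGL ≅ L.homologyDGL) := by
  induction h with
  | rel K L h =>
    obtain ⟨F, hF⟩ := h
    exact nonempty_homologyDGL_iso_of_quasiIso F hF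
  | refl K => exact ⟨Iso.refl _⟩
  | symm K L _ h => exact h.map Iso.symm
  | trans K L M _ _ h h' => exact ⟨h.some ≪≫ h'.some⟩

lemma nonempty_homologyDGL_homologyDGL_iso (L : DGL.{u}) :
    Nonempty (L.homologyDGL.homologyDGL ≅ L.homologyDGL) := by
  let G := L.homologyDGL
  have bdry_eq_zero (n) (x : G.X.X n) (hx : x ∈ G.bdry n) : x = 0 := by
    obtain ⟨y, rfl⟩ := hx
    rfl
  obtain ⟨a⟩ := nonempty_iso_of_bijective G.cyclesIncl fun n =>
    ⟨Subtype.val_injective, fun x => ⟨⟨x, rfl⟩, rfl⟩⟩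
  obtain ⟨b⟩ := nonempty_iso_of_bijective G.cyclesProj fun n =>
    ⟨(injective_iff_map_eq_zero (G.cls n)).2 fun x hx =>
      Subtype.ext (bdry_eq_zero n _ ((G.cls_eq_zero_iff n x).1 hx)), G.cls_surjective n⟩
  exact ⟨b.symm ≪≫ a⟩

/-- The explicit homology in degree `t`, as a functor. -/
def HmodFunctor (t : ℕ) : DGL.{u} ⥤ ModuleCat.{u} ℚ where
  obj K := ModuleCat.of ℚ (K.Hmod t)
  map F := ModuleCat.ofHom (Hmap (Hom.f F) t)
  map_id K := ModuleCat.hom_ext (Hmap_id K t)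
  map_comp F G := ModuleCat.hom_ext (Hmap_comp (Hom.f F) (Hom.f G) t)

/-- The comparison of the explicit homology with Mathlib's homology, as an isomorphism of
functors. -/
def HmodFunctorIso (t : ℕ) : HmodFunctor.{u} t ≅
    toComplex ⋙ HomologicalComplex.homologyFunctor (ModuleCat.{u} ℚ) (ComplexShape.down ℕ) t :=
  NatIso.ofComponents
    (fun K => (LinearEquiv.ofBijective _ (K.toHomology_bijective t)).toModuleIso)
    (fun F => ModuleCat.hom_ext (LinearMap.ext fun x =>
      (homologyMap_toHomology (Hom.f F) t x).symm))

end DGL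

/-! ### Resolutions of constant simplicial vector spaces -/

section Exactness

variable {k : Type w} [Field k]

lemma exists_comp_eq_of_forall_exists {U V Y : ModuleCat.{v} k} (a : U ⟶ V) (f : Y ⟶ V)
    (h : ∀ y, ∃ x, a.hom x = f.hom y) : ∃ g : Y ⟶ U, g ≫ a = f := by
  obtain ⟨g, hg⟩ := exists_linearMap_comp_comp_self a.hom
  refine ⟨f ≫ ModuleCat.ofHom g, ModuleCat.hom_ext (LinearMap.ext fun y => ?_)⟩
  obtain ⟨x, hx⟩ := h y
  change a.hom (g (f.hom y)) = f.hom y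
  rw [← hx, hg]

lemma RelativelyExact.of_exact {P : ChainComplex (ModuleCat.{v} k) ℕ} {G : ModuleCat.{v} k}
    {p : P.X 0 ⟶ G} (zero : P.d 1 0 ≫ p = 0) (surj : Function.Surjective p.hom)
    (exact_zero : ∀ x, p.hom x = 0 → ∃ y, (P.d 1 0).hom y = x)
    (exact_succ : ∀ n x, (P.d (n + 1) n).hom x = 0 → ∃ y, (P.d (n + 2) (n + 1)).hom y = x) :
    RelativelyExact (𝟭 (ModuleCat.{v} k)) P p where
  zero := zero
  surj _ g := exists_comp_eq_of_forall_exists p g fun y => surj (g.hom y)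
  exact_zero _ f hf := exists_comp_eq_of_forall_exists _ f fun y =>
    exact_zero _ (congrArg (fun g => g.hom y) hf)
  exact_succ n _ f hf := exists_comp_eq_of_forall_exists _ f fun y =>
    exact_succ n _ (congrArg (fun g => g.hom y) hf)

/-- The alternating face map complex of a constant simplicial vector space. -/
abbrev constComplex (T : ModuleCat.{v} k) : ChainComplex (ModuleCat.{v} k) ℕ :=
  (alternatingFaceMapComplex _).obj ((SimplicialObject.const _).obj T)

lemma constComplex_d_apply (T : ModuleCat.{v} k) (n : ℕ) (y : T) :
    ((constComplex T).d (n + 1) n).hom y = if Even n then 0 else y := by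
  have hd : (constComplex T).d (n + 1) n = ∑ i : Fin (n + 2), (-1 : ℤ) ^ (i : ℕ) • 𝟙 T :=
    alternatingFaceMapComplex_obj_d _ n
  rw [hd, ← Finset.sum_smul, Fin.sum_univ_eq_sum_range (fun i => (-1 : ℤ) ^ i), neg_one_geom_sum]
  simp only [Nat.even_add, even_two, iff_true]
  split_ifs
  · rw [zero_smul]; rfl
  · rw [one_smul]; rfl

lemma constComplex_exact_succ (T : ModuleCat.{v} k) (n : ℕ) (y : T)
    (hy : ((constComplex T).d (n + 1) n).hom y = 0) :
    ∃ z, ((constComplex T).d (n + 2) (n + 1)).hom z = y := by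
  rw [constComplex_d_apply] at hy
  by_cases hn : Even n
  · exact ⟨y, (constComplex_d_apply T (n + 1) y).trans
      (if_neg (Nat.not_even_iff_odd.2 hn.add_one))⟩
  · exact ⟨0, (map_zero _).trans ((if_neg hn).symm.trans hy).symm⟩

end Exactness

theorem relativelyExact_of_bijective {T : ModuleCat.{u} ℚ} {P : RatComplex.{u}}
    (φ : P ⟶ constComplex T)
    (hφ : ∀ s, Function.Bijective
      (DGL.Hmap (K := DGL.triv P) (L := DGL.triv (constComplex T)) φ s)) :
    RelativelyExact (𝟭 (ModuleCat.{u} ℚ)) P (φ.f 0) := by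
  let C := constComplex T
  have bdry_zero (y) (hy : y ∈ (DGL.triv C).bdry 0) : y = 0 := by
    obtain ⟨z, rfl⟩ := hy
    exact constComplex_d_apply T 0 z
  have mem_bdry (s) (x : (DGL.triv P).cyc s) (hx : (φ.f s).hom x.1 ∈ (DGL.triv C).bdry s) :
      x.1 ∈ (DGL.triv P).bdry s :=
    ((DGL.triv P).cls_eq_zero_iff s x).1 ((injective_iff_map_eq_zero _).1 (hφ s).1 _
      (((DGL.triv C).cls_eq_zero_iff s
        (DGL.cycMap (K := DGL.triv P) (L := DGL.triv C) φ s x)).2 hx))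
  refine .of_exact ?_ (fun y => ?_) (fun x hx => ?_) (fun n x hx => ?_)
  · refine (φ.comm 1 0).symm.trans (ModuleCat.hom_ext (LinearMap.ext fun x => ?_))
    exact constComplex_d_apply T 0 _
  · obtain ⟨c, hc⟩ := (hφ 0).2 ((DGL.triv C).cls 0 ⟨y, RatComplex.d_apply_zero C y⟩)
    obtain ⟨x, rfl⟩ := (DGL.triv P).cls_surjective 0 c
    exact ⟨x.1, sub_eq_zero.1 (bdry_zero _ (((DGL.triv C).cls_eq_iff 0 _ _).1 hc))⟩
  · refine mem_bdry 0 ⟨x, RatComplex.d_apply_zero P x⟩ ?_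
    rw [hx]
    exact zero_mem _
  · refine mem_bdry (n + 1) ⟨x, hx⟩ (constComplex_exact_succ T n _ ?_)
    refine (RatComplex.map_d φ (n + 1) n x).symm.trans ?_
    rw [hx, map_zero]

/-- The transport of a contraction along an isomorphism of the targets of the augmentation. -/
def SimplicialContraction.ofIso {C : Type w} [Category.{v} C] {D : Type w} [Category.{v} D]
    {J : C ⥤ D} {X : SimplicialObject C} {G G' : D} {ε : J.obj (X _⦋0⦌) ⟶ G} {Y : C}
    (S : SimplicialContraction J X ε Y) (e : G ≅ G') :
    SimplicialContraction J X (ε ≫ e.hom) Y where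
  bot g := S.bot (g ≫ e.inv)
  h := S.h
  map_bot g := by
    rw [← Category.assoc, S.map_bot, Category.assoc, e.inv_hom_id, Category.comp_id]
  h_δ_zero := S.h_δ_zero
  h_δ_one f := by
    rw [S.h_δ_one, Category.assoc, Category.assoc, e.hom_inv_id, Category.comp_id]
  h_δ_succ := S.h_δ_succ

/-! ### Free DGLs and maps of their homology -/

namespace DGL

/-- The linear map in degree `n` underlying a map of homology DGLs. -/
def component {K L : DGL.{u}} (φ : K.homologyDGL ⟶ L.homologyDGL) (n : ℕ) :
    K.Hmod n →ₗ[ℚ] L.Hmod n :=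
  ((Hom.f φ).f n).hom

namespace IsFreeOn

variable {V : RatComplex.{u}} {Y : DGL.{u}} {ι : V ⟶ Y.X} (hι : IsFreeOn (L := Y) ι)

lemma exists_homologyDGLFunctor_map_eq (hι : IsFreeOn (L := Y) ι) {K : DGL.{u}}
    (φ : Y.homologyDGL ⟶ K.homologyDGL) : ∃ F : Y ⟶ K, homologyDGLFunctor.map F = φ := by
  obtain ⟨F, hF⟩ := hι.exists_hom_Hmap_eq K fun n => component φ n ∘ₗ Hmap (K := triv V) ι n
  exact ⟨F, hι.homologyDGL_hom_ext fun n => LinearMap.congr_fun (hF n)⟩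

/-- The map of homology DGLs extending given linear maps on the homology of the generators. -/
def homologyExt {K : DGL.{u}} (l : ∀ n, (triv V).Hmod n →ₗ[ℚ] K.Hmod n) :
    Y.homologyDGL ⟶ K.homologyDGL :=
  homologyDGLFunctor.map (hι.exists_hom_Hmap_eq K l).choose

lemma component_homologyExt {K : DGL.{u}} (l : ∀ n, (triv V).Hmod n →ₗ[ℚ] K.Hmod n) (n : ℕ) :
    component (hι.homologyExt l) n ∘ₗ Hmap (K := triv V) ι n = l n :=
  (hι.exists_hom_Hmap_eq K l).choose_spec n

lemma homologyExt_comp_eq {K L : DGL.{u}} {l : ∀ n, (triv V).Hmod n →ₗ[ℚ] K.Hmod n}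
    {φ : K.homologyDGL ⟶ L.homologyDGL} {ψ : Y.homologyDGL ⟶ L.homologyDGL}
    (h : ∀ n, component φ n ∘ₗ l n = component ψ n ∘ₗ Hmap (K := triv V) ι n) :
    hι.homologyExt l ≫ φ = ψ := by
  refine hι.homologyDGL_hom_ext fun n => ?_
  have hn : component φ n ∘ₗ component (hι.homologyExt l) n ∘ₗ Hmap (K := triv V) ι n =
      component ψ n ∘ₗ Hmap (K := triv V) ι n :=
    (congrArg (component φ n ∘ₗ ·) (hι.component_homologyExt l n)).trans (h n)
  exact LinearMap.congr_fun hn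

end IsFreeOn

/-- A free DGL, without a choice of generators. -/
def IsFree (Y : DGL.{u}) : Prop :=
  ∃ (V : RatComplex.{u}) (ι : V ⟶ toComplex.obj Y), IsFreeOn ι

/-- The functors on DGLs that identify any two maps out of a free DGL which induce the same map
on homology. -/
def IsHomologyInvariant {C : Type*} [Category* C] (Φ : DGL.{u} ⥤ C) : Prop :=
  ∀ {Y K : DGL.{u}} {F G : Y ⟶ K}, Y.IsFree →
    homologyDGLFunctor.map F = homologyDGLFunctor.map G → Φ.map F = Φ.map G

lemma isHomologyInvariant_ab_homology (t : ℕ) : IsHomologyInvariant (ab.{u} ⋙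
    HomologicalComplex.homologyFunctor (ModuleCat.{u} ℚ) (ComplexShape.down ℕ) t) := by
  rintro Y K F G ⟨V, ι, hι⟩ h
  obtain ⟨H⟩ := RatComplex.nonempty_homotopy_of_Hmap_eq (IsFreeOn.Hmap_ab_eq hι h)
  exact H.homologyMap_eq t

lemma isHomologyInvariant_ab_hoHom (M : RatComplex.{u}) (t : ℤ) :
    IsHomologyInvariant (ab.{u} ⋙ (hoHom M t).rightOp) := by
  rintro Y K F G ⟨V, ι, hι⟩ h
  obtain ⟨H⟩ := RatComplex.nonempty_homotopy_of_Hmap_eq (IsFreeOn.Hmap_ab_eq hι h)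
  exact congrArg Quiver.Hom.op (hoHom_map_eq_of_homotopy H M t)

end DGL

/-- The free DGLs, as objects of a category whose morphisms are the maps of homology DGLs. -/
structure FreeDGL : Type (u + 1) where
  toDGL : DGL.{u}
  isFree : toDGL.IsFree

namespace FreeDGL

instance : Category.{u} FreeDGL.{u} where
  Hom Y Z := Y.toDGL.homologyDGL ⟶ Z.toDGL.homologyDGL
  id Y := 𝟙 Y.toDGL.homologyDGL
  comp f g := CategoryStruct.comp (obj := DGL.{u}) f g
  id_comp f := Category.id_comp (obj := DGL.{u}) f
  comp_id f := Category.comp_id (obj := DGL.{u}) f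
  assoc f g h := Category.assoc (obj := DGL.{u}) f g h

/-- Homology, as a functor from `FreeDGL` to DGLs. -/
def homology : FreeDGL.{u} ⥤ DGL.{u} where
  obj Y := Y.toDGL.homologyDGL
  map f := f

lemma exists_map_eq (Y : FreeDGL.{u}) {K : DGL.{u}} (φ : Y.toDGL.homologyDGL ⟶ K.homologyDGL) :
    ∃ F : Y.toDGL ⟶ K, DGL.homologyDGLFunctor.map F = φ := by
  obtain ⟨V, ι, hι⟩ := Y.isFree
  exact DGL.IsFreeOn.exists_homologyDGLFunctor_map_eq hι φ

section Lift

variable {C : Type*} [Category* C] {Φ : DGL.{u} ⥤ C} (hΦ : DGL.IsHomologyInvariant Φ)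

/-- The functor on `FreeDGL` induced by a homology invariant functor. -/
def lift : FreeDGL.{u} ⥤ C where
  obj Y := Φ.obj Y.toDGL
  map {_ _} f := Φ.map (exists_map_eq _ f).choose
  map_id Y := by
    rw [← Φ.map_id]
    refine hΦ Y.isFree ((Y.exists_map_eq (K := Y.toDGL) (𝟙 Y)).choose_spec.trans ?_)
    exact (CategoryTheory.Functor.map_id DGL.homologyDGLFunctor Y.toDGL).symm
  map_comp {Y Z W} f g := by
    rw [← Φ.map_comp]
    refine hΦ Y.isFree ((Y.exists_map_eq (K := W.toDGL) (f ≫ g)).choose_spec.trans ?_)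
    rw [Functor.map_comp, (Y.exists_map_eq (K := Z.toDGL) f).choose_spec,
      (Z.exists_map_eq (K := W.toDGL) g).choose_spec]
    rfl

lemma lift_map {Y Z : FreeDGL.{u}} (F : Y.toDGL ⟶ Z.toDGL) :
    (lift hΦ).map (X := Y) (Y := Z) (DGL.homologyDGLFunctor.map F) = Φ.map F :=
  hΦ Y.isFree (Y.exists_map_eq (DGL.homologyDGLFunctor.map F)).choose_spec

end Lift

section Simplicial

variable {A : SimplicialObject DGL.{u}} (hA : ∀ n : ℕ, (A _⦋n⦌).IsFree)

/-- A dimensionwise free simplicial DGL, as a simplicial object of `FreeDGL`. -/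
def simplicial : SimplicialObject FreeDGL.{u} where
  obj n := ⟨A.obj n, hA n.unop.len⟩
  map f := DGL.homologyDGLFunctor.map (A.map f)
  map_id _ := (congrArg _ (A.map_id _)).trans (DGL.homologyDGLFunctor.map_id _)
  map_comp _ _ := (congrArg _ (A.map_comp _ _)).trans (DGL.homologyDGLFunctor.map_comp _ _)

/-- The functor induced by a homology invariant functor `Φ` takes the simplicial object of
`FreeDGL` to the image of `A` under `Φ`. -/
def simplicialCompLift {C : Type*} [Category* C] {Φ : DGL.{u} ⥤ C}
    (hΦ : DGL.IsHomologyInvariant Φ) : simplicial hA ⋙ lift hΦ ≅ A ⋙ Φ :=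
  NatIso.ofComponents (fun _ => Iso.refl _) fun {X Y} f => by
    refine (Category.comp_id _).trans (Eq.trans ?_ (Category.id_comp _).symm)
    exact lift_map hΦ (Y := (simplicial hA).obj X) (Z := (simplicial hA).obj Y) (A.map f)

/-- The alternating face map complex of `Φ(A)`, for `Φ` homology invariant, is the image of a
complex of formal sums under the additive extension of `Φ`. -/
def freeComplexIso {C : Type (u + 1)} [Category.{u} C] [Preadditive C] {Φ : DGL.{u} ⥤ C}
    (hΦ : DGL.IsHomologyInvariant Φ) :
    ((Free.lift ℤ (lift hΦ)).mapHomologicalComplex _).obj (freeComplex (simplicial hA)) ≅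
      (alternatingFaceMapComplex C).obj (((SimplicialObject.whiskering _ _).obj Φ).obj A) :=
  eqToIso (Functor.congr_obj (map_alternatingFaceMapComplex (Free.lift ℤ (lift hΦ))) _) ≪≫
    (alternatingFaceMapComplex C).mapIso
      (Functor.isoWhiskerLeft (simplicial hA) (Free.embeddingLiftIso ℤ (lift hΦ)) ≪≫
        simplicialCompLift hA hΦ)

variable {L : DGL.{u}} (ε : A ⟶ (SimplicialObject.const DGL.{u}).obj L)

/-- The map of homology DGLs induced by an augmentation in simplicial dimension zero. -/
abbrev aug : homology.obj ((simplicial hA) _⦋0⦌) ⟶ L.homologyDGL :=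
  DGL.homologyDGLFunctor.map (ε.app (op ⦋0⦌))

lemma homology_map_δ_comp_aug (i : Fin 2) : homology.map ((simplicial hA).δ i) ≫ aug hA ε =
    DGL.homologyDGLFunctor.map (ε.app (op ⦋1⦌)) := by
  have h : A.δ i ≫ ε.app (op ⦋0⦌) = ε.app (op ⦋1⦌) :=
    (ε.naturality (SimplexCategory.δ i).op).trans (Category.comp_id _)
  rw [← h]
  exact (DGL.homologyDGLFunctor.map_comp _ _).symm

end Simplicial

end FreeDGL

/-! ### Simplicial resolutions -/

theorem nonempty_faceContraction_of_isIso {X : SimplicialObject (ModuleCat.{u} ℚ)}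
    {T : ModuleCat.{u} ℚ} (η : X ⟶ (SimplicialObject.const _).obj T)
    (hη : ∀ s, IsIso (HomologicalComplex.homologyMap
      ((alternatingFaceMapComplex (ModuleCat.{u} ℚ)).map η) s)) :
    Nonempty (FaceContraction X (η.app (op ⦋0⦌))) := by
  have hη' : RelativelyExact (𝟭 (ModuleCat.{u} ℚ)) (G := T)
      ((alternatingFaceMapComplex (ModuleCat.{u} ℚ)).obj X) (η.app (op ⦋0⦌)) :=
    relativelyExact_of_bijective (T := T) ((alternatingFaceMapComplex (ModuleCat.{u} ℚ)).map η)
      fun s => (DGL.isIso_homologyMap_iff _ s).1 (hη s)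
  exact RelativelyExact.nonempty_faceContraction hη'

namespace DGL

/-- The conditions on a free simplicial resolution that do not involve the degeneracies: each
`A_n` is free, and `π_s H_t(A) ⟶ π_s H_t(L)` is an isomorphism for all `s` and `t`. -/
structure IsDimensionwiseFreeResolution {A : SimplicialObject DGL.{u}} {L : DGL.{u}}
    (ε : A ⟶ (SimplicialObject.const DGL.{u}).obj L) : Prop where
  isFree : ∀ n : ℕ, (A _⦋n⦌).IsFree
  isIso : ∀ s t : ℕ, IsIso
    ((piH s t).map (((SimplicialObject.whiskering _ _).obj toComplex).map ε))

variable {A : SimplicialObject DGL.{u}} {L : DGL.{u}}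
  {ε : A ⟶ (SimplicialObject.const DGL.{u}).obj L}

lemma IsFreeResolution.isDimensionwiseFreeResolution (h : IsFreeResolution ε) :
    IsDimensionwiseFreeResolution ε := by
  obtain ⟨V, ι, hι, -⟩ := h.free
  exact ⟨fun n => ⟨V n, ι n, hι n⟩, h.isIso⟩

/-- The augmentation of the simplicial vector space `H_t(A)`. -/
def HmodAug (ε : A ⟶ (SimplicialObject.const DGL.{u}).obj L) (t : ℕ) :
    ((SimplicialObject.whiskering _ _).obj (HmodFunctor t)).obj A ⟶
      (SimplicialObject.const _).obj ((HmodFunctor t).obj L) where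
  app n := (HmodFunctor t).map (ε.app n)
  naturality _ _ f := by
    refine ((HmodFunctor t).map_comp _ _).symm.trans ((congrArg _ (ε.naturality f)).trans ?_)
    exact (congrArg _ (Category.comp_id _)).trans (Category.comp_id _).symm

lemma isIso_homologyMap_HmodAug {s t : ℕ}
    (h : IsIso ((piH s t).map (((SimplicialObject.whiskering _ _).obj toComplex).map ε))) :
    IsIso (HomologicalComplex.homologyMap
      ((alternatingFaceMapComplex (ModuleCat.{u} ℚ)).map (HmodAug ε t)) s) := by
  let π := alternatingFaceMapComplex (ModuleCat.{u} ℚ) ⋙ HomologicalComplex.homologyFunctor _ _ s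
  let W := (SimplicialObject.whiskering DGL.{u} (ModuleCat.{u} ℚ)).obj (HmodFunctor t)
  let α : W ⋙ π ≅ (SimplicialObject.whiskering _ _).obj toComplex ⋙ piH s t :=
    Functor.isoWhiskerRight
      ((SimplicialObject.whiskering DGL.{u} (ModuleCat.{u} ℚ)).mapIso (HmodFunctorIso t)) π
  have hε : IsIso (π.map (W.map ε)) := (NatIso.isIso_map_iff α ε).2 h
  let κ : W.obj ((SimplicialObject.const DGL.{u}).obj L) ≅
      (SimplicialObject.const _).obj ((HmodFunctor t).obj L) :=
    Functor.constComp _ L (HmodFunctor t)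
  have hκ : HmodAug ε t = W.map ε ≫ κ.hom :=
    NatTrans.ext (funext fun _ => (Category.comp_id _).symm)
  have hπ : π.map (HmodAug ε t) = π.map (W.map ε) ≫ π.map κ.hom :=
    (congrArg _ hκ).trans (π.map_comp _ _)
  change IsIso (π.map (HmodAug ε t))
  rw [hπ]
  infer_instance

namespace IsDimensionwiseFreeResolution

lemma nonempty_faceContraction (h : IsDimensionwiseFreeResolution ε) (t : ℕ) :
    Nonempty (FaceContraction (((SimplicialObject.whiskering _ _).obj (HmodFunctor t)).obj A)
      ((HmodAug ε t).app (op ⦋0⦌))) :=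
  nonempty_faceContraction_of_isIso _ fun s => isIso_homologyMap_HmodAug (h.isIso s t)

theorem nonempty_simplicialContraction (h : IsDimensionwiseFreeResolution ε) (Y : FreeDGL.{u}) :
    Nonempty (SimplicialContraction FreeDGL.homology (FreeDGL.simplicial h.isFree)
      (FreeDGL.aug h.isFree ε) Y) := by
  obtain ⟨V, ι, hι⟩ := Y.isFree
  replace hι : IsFreeOn (L := Y.toDGL) ι := hι
  let S (t : ℕ) := (h.nonempty_faceContraction t).some
  let gen (t : ℕ) : (triv V).Hmod t →ₗ[ℚ] Y.toDGL.Hmod t := Hmap (K := triv V) ι t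
  let bot (g : Y.toDGL.homologyDGL ⟶ L.homologyDGL) :
      Y.toDGL.homologyDGL ⟶ (A _⦋0⦌).homologyDGL :=
    hι.homologyExt fun t => (S t).bot.hom ∘ₗ component g t ∘ₗ gen t
  let extra (n : ℕ) (f : Y.toDGL.homologyDGL ⟶ (A _⦋n⦌).homologyDGL) :
      Y.toDGL.homologyDGL ⟶ (A _⦋n + 1⦌).homologyDGL :=
    hι.homologyExt fun t => ((S t).h n).hom ∘ₗ component f t ∘ₗ gen t
  refine ⟨⟨bot, extra, fun g => ?_, fun n f => ?_, fun f => ?_, fun n f i => ?_⟩⟩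
  · refine hι.homologyExt_comp_eq (φ := FreeDGL.aug h.isFree ε) (ψ := g) fun t => ?_
    exact congrArg (fun c => c.hom ∘ₗ component g t ∘ₗ gen t) (S t).bot_comp
  · refine hι.homologyExt_comp_eq (φ := homologyDGLFunctor.map (A.δ 0)) (ψ := f) fun t => ?_
    exact congrArg (fun c => c.hom ∘ₗ component f t ∘ₗ gen t) ((S t).h_δ_zero n)
  · refine hι.homologyExt_comp_eq (φ := homologyDGLFunctor.map (A.δ 1)) fun t => ?_
    refine Eq.trans ?_ (hι.component_homologyExt _ t).symm
    exact congrArg (fun c => c.hom ∘ₗ component f t ∘ₗ gen t) (S t).h_δ_one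
  · refine hι.homologyExt_comp_eq (φ := homologyDGLFunctor.map (A.δ i.succ)) fun t => ?_
    refine Eq.trans ?_ (hι.component_homologyExt _ t).symm
    exact congrArg (fun c => c.hom ∘ₗ component f t ∘ₗ gen t) ((S t).h_δ_succ n i)

theorem relativelyExact (h : IsDimensionwiseFreeResolution ε) {G : DGL.{u}}
    (e : L.homologyDGL ≅ G) :
    RelativelyExact (freeFunctor FreeDGL.homology) (G := (Free.embedding ℤ DGL).obj G)
      (freeComplex (FreeDGL.simplicial h.isFree))
      ((Free.embedding ℤ DGL).map (FreeDGL.aug h.isFree ε ≫ e.hom)) := by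
  refine SimplicialContraction.relativelyExact ?_ fun Y =>
    (h.nonempty_simplicialContraction Y).some.ofIso e
  refine (Category.assoc _ _ _).symm.trans (Eq.trans ?_ (Category.assoc _ _ _))
  exact congrArg (· ≫ e.hom) ((FreeDGL.homology_map_δ_comp_aug h.isFree ε 0).trans
    (FreeDGL.homology_map_δ_comp_aug h.isFree ε 1).symm)

theorem nonempty_homotopyEquiv {C : Type (u + 1)} [Category.{u} C] [Preadditive C]
    {Φ : DGL.{u} ⥤ C} (hΦ : IsHomologyInvariant Φ) {L' : DGL.{u}}
    (e : L.homologyDGL ≅ L'.homologyDGL) {A' : SimplicialObject DGL.{u}}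
    {ε' : A' ⟶ (SimplicialObject.const DGL.{u}).obj L'} (h : IsDimensionwiseFreeResolution ε)
    (h' : IsDimensionwiseFreeResolution ε') :
    Nonempty (HomotopyEquiv
      ((alternatingFaceMapComplex C).obj (((SimplicialObject.whiskering _ _).obj Φ).obj A))
      ((alternatingFaceMapComplex C).obj (((SimplicialObject.whiskering _ _).obj Φ).obj A'))) := by
  obtain ⟨E⟩ := (h.relativelyExact e).nonempty_homotopyEquiv (h'.relativelyExact (Iso.refl _))
  exact ⟨(HomotopyEquiv.ofIso (FreeDGL.freeComplexIso h.isFree hΦ).symm).trans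
    (((Free.lift ℤ (FreeDGL.lift hΦ)).mapHomotopyEquiv E).trans
      (HomotopyEquiv.ofIso (FreeDGL.freeComplexIso h'.isFree hΦ)))⟩

end IsDimensionwiseFreeResolution

end DGL

/-! ### Cohomology -/

/-- The alternating coface map complex, as the opposite of an alternating face map complex. -/
def alternatingCofaceMapComplexIso {C : Type*} [Category* C] [Preadditive C]
    (X : CosimplicialObject C) : (alternatingCofaceMapComplex C).obj X ≅
      ((alternatingFaceMapComplex Cᵒᵖ).obj
        ((cosimplicialSimplicialEquiv C).functor.obj (op X))).unop :=
  HomologicalComplex.Hom.isoOfComponents (fun _ => Iso.refl _) (by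
    rintro n _ rfl
    refine (Category.id_comp _).trans (Eq.trans ?_ (Category.comp_id _).symm)
    refine Eq.trans ?_ (CochainComplex.of_d _ _ _).symm
    have h := alternatingFaceMapComplex_obj_d
      ((cosimplicialSimplicialEquiv C).functor.obj (op X)) n
    exact (congrArg Quiver.Hom.unop h).trans (AlternatingCofaceMapComplex.d_eq_unop_d _ n).symm)

/-- The cohomology of a cosimplicial object, as the homology of the opposite simplicial object. -/
def alternatingCofaceMapComplexHomologyIso {C : Type*} [Category* C] [Abelian C]
    (X : CosimplicialObject C) (Y : SimplicialObject Cᵒᵖ)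
    (e : Y ≅ (cosimplicialSimplicialEquiv C).functor.obj (op X)) (n : ℕ) :
    ((alternatingCofaceMapComplex C).obj X).homology n ≅
      (((alternatingFaceMapComplex Cᵒᵖ).obj Y).homology n).unop :=
  HomologicalComplex.homologyMapIso (alternatingCofaceMapComplexIso X) n ≪≫
    HomologicalComplex.homologyUnop _ n ≪≫
    (HomologicalComplex.homologyMapIso ((alternatingFaceMapComplex Cᵒᵖ).mapIso e) n).unop

/-- The cosimplicial vector space computing cohomology, as a simplicial object of the opposite
category. -/
def cosimplicialHoHomIso (A : SimplicialObject DGL.{u}) (M : RatComplex.{u}) (t : ℤ) :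
    ((SimplicialObject.whiskering _ _).obj (DGL.ab ⋙ (hoHom M t).rightOp)).obj A ≅
      (cosimplicialSimplicialEquiv (ModuleCat.{u} ℚ)).functor.obj
        (op (Functor.rightOp (((SimplicialObject.whiskering _ _).obj DGL.ab).obj A) ⋙ hoHom M t)) :=
  NatIso.ofComponents (fun _ => Iso.refl _) fun _ =>
    (Category.comp_id _).trans (Category.id_comp _).symm

theorem mainTheorem6_general {L L' : DGL.{u}} (e : L.homologyDGL ≅ L'.homologyDGL)
    {A A' : SimplicialObject DGL.{u}} {ε : A ⟶ (SimplicialObject.const DGL.{u}).obj L}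
    {ε' : A' ⟶ (SimplicialObject.const DGL.{u}).obj L'}
    (hA : DGL.IsDimensionwiseFreeResolution ε) (hA' : DGL.IsDimensionwiseFreeResolution ε') :
    (∀ n t : ℕ, Nonempty (DGL.bigradedHomology A n t ≅ DGL.bigradedHomology A' n t)) ∧
    (∀ (M : RatComplex.{u}) (n : ℕ) (t : ℤ),
      Nonempty (DGL.bigradedCohomology A M n t ≅ DGL.bigradedCohomology A' M n t)) := by
  refine ⟨fun n t => ?_, fun M n t => ?_⟩
  · obtain ⟨E⟩ := hA.nonempty_homotopyEquiv (DGL.isHomologyInvariant_ab_homology t) e hA'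
    exact ⟨E.toHomologyIso n⟩
  · obtain ⟨E⟩ := hA.nonempty_homotopyEquiv (DGL.isHomologyInvariant_ab_hoHom M t) e hA'
    exact ⟨alternatingCofaceMapComplexHomologyIso _ _ (cosimplicialHoHomIso A M t) n ≪≫
      (E.toHomologyIso n).symm.unop ≪≫
      (alternatingCofaceMapComplexHomologyIso _ _ (cosimplicialHoHomIso A' M t) n).symm⟩

end

theorem mainTheorem6 (L L' : DGL.{u}) (hL' : DGL.WeaklyEquivalent L' L.homologyDGL)
    (A A' : SimplicialObject DGL.{u})
    (ε : A ⟶ (SimplicialObject.const DGL.{u}).obj L)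
    (ε' : A' ⟶ (SimplicialObject.const DGL.{u}).obj L')
    (hA : DGL.IsFreeResolution ε) (hA' : DGL.IsFreeResolution ε') :
    (∀ n t : ℕ, ∃ f : DGL.bigradedHomology A n t →ₗ[ℚ] DGL.bigradedHomology A' n t,
      Function.Injective f) ∧
    (∀ (M : RatComplex.{u}) (n : ℕ) (t : ℤ),
      ∃ f : DGL.bigradedCohomology A M n t →ₗ[ℚ] DGL.bigradedCohomology A' M n t,
        Function.Injective f) := by
  obtain ⟨a⟩ := hL'.nonempty_homologyDGL_iso
  obtain ⟨b⟩ := DGL.nonempty_homologyDGL_homologyDGL_iso L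
  exact (mainTheorem6_general (a ≪≫ b).symm hA.isDimensionwiseFreeResolution
    hA'.isDimensionwiseFreeResolution).imp
      (fun h n t => (h n t).elim fun i => ⟨i.hom.hom, i.toLinearEquiv.injective⟩)
      (fun h M n t => (h M n t).elim fun i => ⟨i.hom.hom, i.toLinearEquiv.injective⟩)
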